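/- Let $p$ be a prime, $k\ge 1$ an integer, $\Gamma=\mathrm{SL}_2(\mathbb{Z}[1/p])$ and $\mathcal{H}_p=\mathbb{P}_1(\mathbb{C}_p)\setminus\mathbb{P}_1(\mathbb{Q}_p)$. For $n\ge 0$ let $\mathcal{H}_p^{\le n}\subset\mathcal{H}_p$ be the affinoid obtained from $\mathbb{P}_1(\mathbb{C}_p)$ by removing the open disks of radius $p^{-n}$ around the points of $\mathbb{P}_1(\mathbb{Q}_p)$. A function on $\mathcal{H}_p$ is rigid meromorphic if on each $\mathcal{H}_p^{\le n}$ it is a quotient $g/h$ with $h\not\equiv 0$, where $g$ and $h$ are uniform limits on $\mathcal{H}_p^{\le n}$ of rational functions without poles in $\mathcal{H}_p^{\le n}$; as usual, two such functions are identified if they agree on each $\mathcal{H}_p^{\le n}$ away from finitely many points. A rigid meromorphic cocycle of weight $w$ is a function $J$ from $\mathbb{P}_1(\mathbb{Q})\times\mathbb{P}_1(\mathbb{Q})$ to rigid meromorphic functions on $\mathcal{H}_p$ with $J\{r,s\}=-J\{s,r\}$, $J\{r,s\}+J\{s,t\}=J\{r,t\}$ for all $r,s,t$, and $(cz+d)^{-w}\,J\{\gamma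 r,\gamma s\}\!\left(\frac{az+b}{cz+d}\right)=J\{r,s\}(z)$ for all $\gamma=\begin{pmatrix}a&b\\c&d\end{pmatrix}\in\Gamma$. A rigid meromorphic period function of weight $w$ is the value $J\{0,\infty\}$ of such a cocycle. Let $\tau\in\mathcal{H}_p$ be a real multiplication point, i.e. $\mathbb{Q}(\tau)$ is a real quadratic field, and fix an embedding $\mathbb{Q}(\tau)\hookrightarrow\mathbb{R}$. For $\omega\in\Gamma\tau\subset\mathbb{Q}(\tau)$ let $\omega'$ be its Galois conjugate, and let $Q_\omega=[A,B,C]$ be the unique binary quadratic form $Ax^2+Bxy+Cy^2$ with coprime integer coefficients such that $Q_\omega(\omega,1)=0$ and $\omega=\frac{-B+\sqrt{D_\omega}}{2A}$, where $D_\omega=B^2-4AC$ and $\sqrt{D_\omega}=D_\omega^{1/2}\in\mathbb{Q}(\tau)\subset\mathbb{C}_p$ is the square root of $D_\omega$ that is positive in $\mathbb{R}$. Let $\gamma_{Q_\omega}$ be the oriented geodesic from $\omega$ to $\omega'$ (viewed in $\mathbb{R}$) in the complex upper half plane, for $r,s\in\mathbb{P}_1(\mathbb{Q})$ let $(r,s)$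 be the oriented geodesic from $r$ to $s$ (empty if $r=s$), and let $\gamma_{Q_\omega}\cdot(r,s)\in\{-1,0,1\}$ be their intersection number, for either fixed choice of orientation of the upper half plane. Put $$\Sigma_\tau(0,\infty)=\{\omega\in\Gamma\tau:\ \omega\omega'<0\},\qquad \Sigma_\tau(r,s)=\{\omega\in\Gamma\tau:\ \gamma_{Q_\omega}\text{ meets }(r,s)\}.$$ Then: 1. The sum $$\varphi_\tau(z)=\sum_{\omega\in\Sigma_\tau(0,\infty)}\big(\gamma_{Q_\omega}\cdot(0,\infty)\big)\frac{D_\omega^{k/2}}{Q_\omega(z,1)^k}$$ converges uniformly on affinoids: for each affinoid subset $X\subset\mathcal{H}_p$, all but finitely many terms have no pole in $X$, and the sum of the remaining terms converges uniformly (and unconditionally) on $X$. The limit $\varphi_\tau$ is a rigid meromorphic period function of weight $2k$. 2. In the same sense, for all $r,s\in\mathbb{P}_1(\mathbb{Q})$ the sum $$\Phi_\tau\{r,s\}(z)=\sum_{\omega\in\Sigma_\tau(r,s)}\big(\gamma_{Q_\omega}\cdot(r,s)\big)\frac{D_\omega^{k/2}}{Q_\omega(z,1)^k}$$ converges uniformly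 on affinoids. The function $\Phi_\tau$ is a rigid meromorphic cocycle of weight $2k$. The two definitions of $\Sigma_\tau(0,\infty)$ agree, and $\varphi_\tau=\Phi_\tau\{0,\infty\}$. 3. $\varphi_\tau$ and $\Phi_\tau$ depend only on the orbit $\Gamma\tau$ (for the fixed embedding of $\mathbb{Q}(\tau)$ into $\mathbb{R}$). -/

import Mathlib

open scoped PadicComplex IntermediateField MatrixGroups

namespace RMPeriod

noncomputable section

/-! ### The `p`-adic upper half plane and its rigid functions -/

/-- The `p`-adic upper half plane `ℙ¹(ℂ_p) - ℙ¹(ℚ_p)`, as a subset of `ℂ_p`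
(the point `∞` lies in `ℙ¹(ℚ_p)`). -/
def Hp (p : ℕ) [Fact p.Prime] : Set ℂ_[p] :=
  (Set.range (algebraMap ℚ_[p] ℂ_[p]))ᶜ

/-- The affinoid of points of the `p`-adic upper half plane that reduce to the subtree of
vertices at distance at most `n` from the standard vertex: the complement in `ℙ¹(ℂ_p)` of the
open disks of radius `p⁻ⁿ` around the points `(u : v)` of `ℙ¹(ℚ_p)`.  Here `(u, v)` is a primitive
vector of `ℤ_p²`, and `z` stands for the vector `(z, 1)` scaled by `max 1 ‖z‖`. -/
def HpLe (p : ℕ) [Fact p.Prime] (n : ℕ) : Set ℂ_[p] :=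
  {z | ∀ u v : ℤ_[p], max ‖u‖ ‖v‖ = 1 →
    ((p : ℝ) ^ n)⁻¹ * max 1 ‖z‖ ≤
      ‖algebraMap ℚ_[p] ℂ_[p] (v : ℚ_[p]) * z - algebraMap ℚ_[p] ℂ_[p] (u : ℚ_[p])‖}

/-- A connected affinoid subset of `ℙ¹(ℂ_p) - {∞}`: a closed disk minus finitely many open disks,
with radii in the value group. -/
def IsConnectedAffinoid (p : ℕ) [Fact p.Prime] (X : Set ℂ_[p]) : Prop :=
  ∃ (a b : ℂ_[p]) (I : Finset (ℂ_[p] × ℂ_[p])), b ≠ 0 ∧ (∀ i ∈ I, i.2 ≠ 0) ∧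
    X = {z | ‖z - a‖ ≤ ‖b‖ ∧ ∀ i ∈ I, ‖i.2‖ ≤ ‖z - i.1‖}

/-- An affinoid subset of `ℙ¹(ℂ_p) - {∞}`: a finite union of connected ones. -/
def IsAffinoid (p : ℕ) [Fact p.Prime] (X : Set ℂ_[p]) : Prop :=
  ∃ C : Set (Set ℂ_[p]), C.Finite ∧ (∀ Y ∈ C, IsConnectedAffinoid p Y) ∧ X = ⋃₀ C

/-- Analytic functions on a set `X` (to be used for the affinoids `HpLe p n`): uniform limits on
`X` of rational functions without poles in `X`. -/
def IsAnalyticOnAffinoid {p : ℕ} [Fact p.Prime] (X : Set ℂ_[p]) (f : ℂ_[p] → ℂ_[p]) : Prop :=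
  ∀ δ : ℝ, 0 < δ → ∃ P Q : Polynomial ℂ_[p],
    ∀ z ∈ X, Q.eval z ≠ 0 ∧ ‖f z - P.eval z / Q.eval z‖ ≤ δ

/-- `f` represents a rigid meromorphic function on the `p`-adic upper half plane: on each `HpLe p n`
it is a quotient of analytic functions, with denominator not identically zero.  The values of `f`
at the zeros of the denominators, and outside the `p`-adic upper half plane, are irrelevant. -/
def IsRigidMeromorphic (p : ℕ) [Fact p.Prime] (f : ℂ_[p] → ℂ_[p]) : Prop :=
  ∀ n : ℕ, ∃ g h : ℂ_[p] → ℂ_[p],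
    IsAnalyticOnAffinoid (HpLe p n) g ∧ IsAnalyticOnAffinoid (HpLe p n) h ∧
    (∃ z ∈ HpLe p n, h z ≠ 0) ∧ ∀ z ∈ HpLe p n, h z ≠ 0 → f z = g z / h z

/-- `f` and `g` represent the same meromorphic function: on each affinoid `HpLe p n`
they agree away from finitely many points. -/
def MeroEq (p : ℕ) [Fact p.Prime] (f g : ℂ_[p] → ℂ_[p]) : Prop :=
  ∀ n : ℕ, {z ∈ HpLe p n | f z ≠ g z}.Finite

/-! ### The group `SL₂(ℤ[1/p])` and its actions -/

/-- The subring `ℤ[1/p]` of `ℚ`. -/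
def ZInv (p : ℕ) : Subalgebra ℤ ℚ := Algebra.adjoin ℤ {(p : ℚ)⁻¹}

/-- The group `Γ = SL₂(ℤ[1/p])`, as a subgroup of `SL₂(ℚ)`. -/
def Gam (p : ℕ) : Subgroup SL(2, ℚ) :=
  (Matrix.SpecialLinearGroup.map (n := Fin 2) (ZInv p).val.toRingHom).range

/-- `(a z + b) / (c z + d)`. -/
def moebius {F : Type*} [Field F] (γ : SL(2, ℚ)) (z : F) : F :=
  ((γ 0 0 : F) * z + (γ 0 1 : F)) / ((γ 1 0 : F) * z + (γ 1 1 : F))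

/-- The weight `w` action `(f | γ)(z) = (c z + d)⁻ʷ f ((a z + b) / (c z + d))`. -/
def slash {p : ℕ} [Fact p.Prime] (w : ℕ) (f : ℂ_[p] → ℂ_[p]) (γ : SL(2, ℚ)) : ℂ_[p] → ℂ_[p] :=
  fun z => (((γ 1 0 : ℂ_[p]) * z + (γ 1 1 : ℂ_[p])) ^ w)⁻¹ * f (moebius γ z)

/-- A rigid meromorphic cocycle of weight `w`: a `Γ`-invariant modular symbol on
`ℙ¹(ℚ)` (here `OnePoint ℚ`) with values in rigid meromorphic functions. -/
structure IsRigidMeromorphicCocycle (p : ℕ) [Fact p.Prime] (w : ℕ)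
    (J : OnePoint ℚ → OnePoint ℚ → ℂ_[p] → ℂ_[p]) : Prop where
  meromorphic : ∀ r s, IsRigidMeromorphic p (J r s)
  antisymm : ∀ r s, MeroEq p (J r s) (-J s r)
  add : ∀ r s t, MeroEq p (J r s + J s t) (J r t)
  invariant : ∀ γ ∈ Gam p, ∀ r s,
    MeroEq p (slash w (J ((γ : GL (Fin 2) ℚ) • r) ((γ : GL (Fin 2) ℚ) • s)) γ) (J r s)

/-- A rigid meromorphic period function of weight `w`: the value at `{0, ∞}` of a rigid
meromorphic cocycle of weight `w`. -/
def IsRigidMeromorphicPeriodFunction (p : ℕ) [Fact p.Prime] (w : ℕ) (f : ℂ_[p] → ℂ_[p]) : Prop :=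
  IsRigidMeromorphic p f ∧
    ∃ J, IsRigidMeromorphicCocycle p w J ∧ MeroEq p f (J ((0 : ℚ) : OnePoint ℚ) OnePoint.infty)

/-! ### Geodesics in the complex upper half plane -/

/-- Homogeneous coordinates of a point of `ℙ¹(ℝ)`. -/
def homog (x : OnePoint ℝ) : ℝ × ℝ := x.elim (1, 0) (fun t => (t, 1))

/-- The hyperbolic geodesic with end points `x` and `y` in `ℙ¹(ℝ)`.  For real `x`, `y` the equation
reads `Re ((x - z) * conj (y - z)) = 0`, the circle with diameter `[x, y]`; for real `x` and `y = ∞`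
it reads `x = Re z`.  It is empty if `x = y`. -/
def geodesic (x y : OnePoint ℝ) : Set UpperHalfPlane :=
  {z | ((((homog x).1 : ℂ) - (homog x).2 * (z : ℂ)) *
    (starRingEnd ℂ) (((homog y).1 : ℂ) - (homog y).2 * (z : ℂ))).re = 0}

/-- The determinant of the homogeneous coordinates of two points. -/
def bdet (x y : OnePoint ℝ) : ℝ := (homog x).1 * (homog y).2 - (homog x).2 * (homog y).1

/-- The cyclic orientation of three points of the circle `ℙ¹(ℝ)`: `1` if they are distinct and
met in this order when moving in the increasing direction of `ℝ`, `-1` if they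
are distinct and met in the opposite order, `0` if two of them coincide. -/
def cyc (x y z : OnePoint ℝ) : ℤ := SignType.sign (bdet x y * bdet y z * bdet z x)

open scoped Classical in
/-- The intersection number of the oriented geodesics from `x` to `y` and from `r` to `s`.
For `ε = 1` (the usual orientation of the upper half plane) a crossing counts `1` if the geodesic
from `r` to `s` goes from the right of the other one to its left, that is, if
`x`, `r`, `y`, `s` are in increasing cyclic order, and `-1` otherwise;
`ε = -1` is the opposite orientation.  Geodesics that do not meet, or that coincide, have
intersection number `0`. -/
def interNumber (ε : ℤˣ) (x y r s : OnePoint ℝ) : ℤ :=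
  if (geodesic x y ∩ geodesic r s).Nonempty then (ε : ℤ) * cyc x r y else 0

/-- The inclusion `ℙ¹(ℚ) → ℙ¹(ℝ)`. -/
def ratPoint (r : OnePoint ℚ) : OnePoint ℝ := r.map (fun q : ℚ => (q : ℝ))

/-! ### Binary quadratic forms attached to real quadratic numbers -/

/-- The integral binary quadratic form `a x² + b x y + c y²`. -/
@[ext]
structure IntForm where
  a : ℤ
  b : ℤ
  c : ℤ

/-- The discriminant. -/
def IntForm.disc (Q : IntForm) : ℤ := Q.b ^ 2 - 4 * Q.a * Q.c

/-- The value `Q(z, 1)`. -/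
def IntForm.eval {F : Type*} [Field F] (Q : IntForm) (z : F) : F :=
  (Q.a : F) * z ^ 2 + (Q.b : F) * z + (Q.c : F)

/-- Coprimality of the coefficients. -/
def IntForm.Primitive (Q : IntForm) : Prop := Int.gcd (Int.gcd Q.a Q.b) Q.c = 1

section Quadratic

variable {K : Type*} [Field K]

/-- `Q` has integer coprime coefficients, `Q(ω, 1) = 0`, and `ω` is the first root
`(-b + √D) / 2a` of `Q`, where `√D` is the square root of the discriminant `D` in `K` which is
positive under the real embedding `σ`. -/
def IsFormOf (σ : K →+* ℝ) (ω : K) (Q : IntForm) : Prop :=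
  Q.Primitive ∧ Q.eval ω = 0 ∧
    ∃ s : K, s ^ 2 = (Q.disc : K) ∧ 0 < σ s ∧ ω = (-(Q.b : K) + s) / (2 * (Q.a : K))

/-- For an irrational number in a real quadratic field the form exists and is unique. -/
theorem existsUnique_isFormOf [CharZero K] (hK : Module.finrank ℚ K = 2) (σ : K →+* ℝ) (ω : K)
    (hω : ω ∉ Set.range (algebraMap ℚ K)) : ∃! Q : IntForm, IsFormOf σ ω Q := by
  have hlin : ∀ a b : ℤ, (a : K) * ω + b = 0 → a = 0 ∧ b = 0 := by
    intro a b h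
    by_cases ha : a = 0
    · subst ha
      refine ⟨rfl, ?_⟩
      simpa using h
    · exfalso
      apply hω
      have ha' : (a : K) ≠ 0 := by exact_mod_cast ha
      refine ⟨-(b : ℚ) / a, ?_⟩
      simp only [map_div₀, map_neg, map_intCast]
      field_simp
      linear_combination -h
  -- a nonzero integral relation
  have hex : ∃ a b c : ℤ, (a : K) * ω ^ 2 + b * ω + c = 0 ∧ ¬ (a = 0 ∧ b = 0 ∧ c = 0) := by
    have : FiniteDimensional ℚ K := Module.finite_of_finrank_pos (by omega)
    have hd : ¬ LinearIndependent ℚ ![ω ^ 2, ω, 1] := by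
      intro h
      have := h.fintype_card_le_finrank
      simp [hK] at this
    rw [Fintype.not_linearIndependent_iff] at hd
    obtain ⟨g, hg, hne⟩ := hd
    simp only [Fin.sum_univ_three, Matrix.cons_val_zero, Matrix.cons_val_one,
      Matrix.cons_val, Algebra.smul_def, eq_ratCast, mul_one] at hg
    have hden : ∀ i, ((g i).den : K) ≠ 0 := fun i => by exact_mod_cast (g i).den_nz
    have hg' : ∀ i, (g i : K) * (g i).den = (g i).num := fun i => by
      exact_mod_cast congrArg (fun q : ℚ => (q : K)) (Rat.mul_den_eq_num (g i))
    refine ⟨(g 0).num * (g 1).den * (g 2).den, (g 1).num * (g 0).den * (g 2).den,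
      (g 2).num * (g 0).den * (g 1).den, ?_, ?_⟩
    · push_cast
      rw [← hg' 0, ← hg' 1, ← hg' 2]
      linear_combination ((g 0).den : K) * (g 1).den * (g 2).den * hg
    · rintro ⟨h0, h1, h2⟩
      obtain ⟨i, hi⟩ := hne
      simp at h0 h1 h2
      fin_cases i <;> simp_all
  -- a primitive one
  have hprim : ∃ Q : IntForm, Q.Primitive ∧ Q.eval ω = 0 := by
    obtain ⟨a, b, c, h, hne⟩ := hex
    set d : ℕ := Int.gcd (Int.gcd a b) c with hd
    have hd0 : d ≠ 0 := by
      intro h0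
      apply hne
      rw [hd, Int.gcd_eq_zero_iff] at h0
      obtain ⟨h1, h2⟩ := h0
      have h1' : Int.gcd a b = 0 := by exact_mod_cast h1
      rw [Int.gcd_eq_zero_iff] at h1'
      exact ⟨h1'.1, h1'.2, h2⟩
    have hdab : (d : ℤ) ∣ (Int.gcd a b : ℤ) := Int.gcd_dvd_left ..
    obtain ⟨a', ha⟩ : (d : ℤ) ∣ a := hdab.trans (Int.gcd_dvd_left ..)
    obtain ⟨b', hb⟩ : (d : ℤ) ∣ b := hdab.trans (Int.gcd_dvd_right ..)
    obtain ⟨c', hc⟩ : (d : ℤ) ∣ c := Int.gcd_dvd_right ..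
    refine ⟨⟨a', b', c'⟩, ?_, ?_⟩
    · have : d = d * Int.gcd (Int.gcd a' b') c' := by
        conv_lhs => rw [hd, ha, hb, hc, Int.gcd_mul_left, Int.natAbs_natCast]
        push_cast
        rw [Int.gcd_mul_left, Int.natAbs_natCast]
      have h1 : d * 1 = d * Int.gcd (Int.gcd a' b') c' := by rw [mul_one]; exact this
      exact (Nat.eq_of_mul_eq_mul_left (Nat.pos_of_ne_zero hd0) h1).symm
    · have hdK : (d : K) ≠ 0 := by exact_mod_cast hd0
      apply mul_left_cancel₀ hdK
      rw [ha, hb, hc] at h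
      push_cast at h
      simp only [IntForm.eval]
      linear_combination h
  have ha0 : ∀ Q : IntForm, Q.Primitive → Q.eval ω = 0 → Q.a ≠ 0 := by
    intro Q hQ h0 ha
    simp only [IntForm.eval, ha, Int.cast_zero, zero_mul, zero_add] at h0
    obtain ⟨hb, hc⟩ := hlin _ _ h0
    simp [IntForm.Primitive, ha, hb, hc] at hQ
  obtain ⟨Q, hQ, hQ0⟩ : ∃ Q : IntForm, IsFormOf σ ω Q := by
    obtain ⟨Q, hQ, h0⟩ := hprim
    have haQ := ha0 Q hQ h0
    have haK : (Q.a : K) ≠ 0 := by exact_mod_cast haQ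
    have hs0 : σ (2 * Q.a * ω + Q.b) ≠ 0 := by
      intro h
      rw [map_eq_zero_iff σ σ.injective] at h
      have := (hlin (2 * Q.a) Q.b (by push_cast; exact h)).1
      omega
    have hsq : (2 * (Q.a : K) * ω + Q.b) ^ 2 = (Q.disc : K) := by
      simp only [IntForm.eval] at h0
      simp only [IntForm.disc]
      push_cast
      linear_combination 4 * (Q.a : K) * h0
    rcases lt_or_gt_of_ne hs0 with hneg | hpos
    · refine ⟨⟨-Q.a, -Q.b, -Q.c⟩, ?_, ?_, -(2 * Q.a * ω + Q.b), ?_, ?_, ?_⟩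
      · simpa [IntForm.Primitive] using hQ
      · simp only [IntForm.eval] at h0 ⊢
        push_cast
        linear_combination -h0
      · rw [neg_sq, hsq]
        simp [IntForm.disc]
      · rw [map_neg]; linarith
      · push_cast
        field_simp
        ring
    · refine ⟨Q, hQ, h0, _, hsq, hpos, ?_⟩
      field_simp
      ring
  refine ⟨Q, ⟨hQ, hQ0⟩, ?_⟩
  rintro R ⟨hR, hR0, s, hs2, hs, hsω⟩
  obtain ⟨hQ0, s', hs2', hs', hsω'⟩ := hQ0
  have haQ := ha0 Q hQ hQ0
  have haR := ha0 R hR hR0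
  have haQK : (Q.a : K) ≠ 0 := by exact_mod_cast haQ
  have haRK : (R.a : K) ≠ 0 := by exact_mod_cast haR
  obtain ⟨e1, e2⟩ := hlin (Q.a * R.b - R.a * Q.b) (Q.a * R.c - R.a * Q.c) (by
    simp only [IntForm.eval] at hQ0 hR0
    push_cast
    linear_combination (Q.a : K) * hR0 - (R.a : K) * hQ0)
  -- proportional primitive vectors
  have hdvd : ∀ P P' : IntForm, P.Primitive → P.a * P'.b = P'.a * P.b → P.a * P'.c = P'.a * P.c →
      P.a ∣ P'.a := by
    intro P P' hP h1 h2
    have hab : P.a ∣ P'.a * (Int.gcd P.a P.b : ℤ) := by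
      rw [Int.gcd_eq_gcd_ab, mul_add]
      refine dvd_add ⟨P'.a * Int.gcdA P.a P.b, by ring⟩ ⟨P'.b * Int.gcdB P.a P.b, ?_⟩
      linear_combination (-Int.gcdB P.a P.b) * h1
    have : P.a ∣ P'.a * (Int.gcd (Int.gcd P.a P.b) P.c : ℤ) := by
      rw [Int.gcd_eq_gcd_ab, mul_add]
      refine dvd_add ?_ ⟨P'.c * Int.gcdB (Int.gcd P.a P.b) P.c, ?_⟩
      · rw [← mul_assoc]; exact hab.mul_right _
      · linear_combination (-Int.gcdB (Int.gcd P.a P.b) P.c) * h2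
    have hP' : Int.gcd (Int.gcd P.a P.b) P.c = 1 := hP
    rw [hP'] at this
    simpa using this
  have d1 := hdvd Q R hQ (by linarith) (by linarith)
  have d2 := hdvd R Q hR (by linarith) (by linarith)
  have key : R.a = Q.a := by
    rcases Int.natAbs_eq_natAbs_iff.mp (Int.natAbs_eq_of_dvd_dvd d2 d1) with h | h
    · exact h
    · exfalso
      have hb : R.b = -Q.b := by
        rw [h] at e1
        have : Q.a * (R.b + Q.b) = 0 := by linear_combination e1
        rcases mul_eq_zero.mp this with h' | h'
        · exact absurd h' haQ
        · linarith
      have hss : s = -s' := by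
        rw [h, hb] at hsω
        rw [hsω'] at hsω
        push_cast at hsω
        field_simp at hsω
        linear_combination hsω
      rw [hss, map_neg] at hs
      linarith
  rw [key] at e1 e2
  have hb : Q.a * (R.b - Q.b) = 0 := by linear_combination e1
  have hc : Q.a * (R.c - Q.c) = 0 := by linear_combination e2
  ext
  · exact key
  · rcases mul_eq_zero.mp hb with h' | h'
    · exact absurd h' haQ
    · linarith
  · rcases mul_eq_zero.mp hc with h' | h'
    · exact absurd h' haQ
    · linarith

open scoped Classical in
/-- The form `Q_ω`. -/
def formOf (σ : K →+* ℝ) (ω : K) : IntForm :=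
  if h : ∃ Q, IsFormOf σ ω Q then h.choose else ⟨0, 0, 0⟩

open scoped Classical in
/-- The square root in `K` of the integer `D` that is positive under the real embedding `σ`
(`0` if there is none). -/
def posSqrt (σ : K →+* ℝ) (D : ℤ) : K :=
  if h : ∃ s : K, s ^ 2 = (D : K) ∧ 0 < σ s then h.choose else 0

/-- The Galois conjugate of an element of a quadratic field. -/
def galConj [CharZero K] (ω : K) : K := algebraMap ℚ K (Algebra.trace ℚ K ω) - ω

/-- The intersection number of the geodesic from the first to the second root of `Q_ω`, that is
from `ω` to its conjugate, with the geodesic from `r` to `s`. -/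
def rmInter [CharZero K] (ε : ℤˣ) (σ : K →+* ℝ) (ω : K) (r s : OnePoint ℚ) : ℤ :=
  interNumber ε (σ ω : OnePoint ℝ) (σ (galConj ω) : OnePoint ℝ) (ratPoint r) (ratPoint s)

/-- The orbit `Γ τ`. -/
def orbit (p : ℕ) (τ : K) : Set K := {ω | ∃ γ ∈ Gam p, ω = moebius γ τ}

/-- `Σ_τ(0, ∞)`: the `ω` in `Γ τ` with `ω ω' < 0`. -/
def SigmaZeroInfty [CharZero K] (p : ℕ) (σ : K →+* ℝ) (τ : K) : Set K :=
  {ω ∈ orbit p τ | σ ω * σ (galConj ω) < 0}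

/-- `Σ_τ(r, s)`: the `ω` in `Γ τ` such that the geodesic joining `ω` and `ω'` meets the geodesic
joining `r` and `s`. -/
def SigmaSet [CharZero K] (p : ℕ) (σ : K →+* ℝ) (τ : K) (r s : OnePoint ℚ) : Set K :=
  {ω ∈ orbit p τ | (geodesic (σ ω : OnePoint ℝ) (σ (galConj ω) : OnePoint ℝ) ∩
    geodesic (ratPoint r) (ratPoint s)).Nonempty}

end Quadratic

/-! ### The series -/

/-- `τ` is a real multiplication point of the `p`-adic upper half plane: `ℚ(τ)` is a real quadratic
field. -/
def IsRM (p : ℕ) [Fact p.Prime] (τ : ℂ_[p]) : Prop :=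
  τ ∈ Hp p ∧ Module.finrank ℚ ℚ⟮τ⟯ = 2 ∧ Nonempty (ℚ⟮τ⟯ →+* ℝ)

section Series

variable {p : ℕ} [Fact p.Prime] {K : IntermediateField ℚ ℂ_[p]}

/-- The term `(γ_{Q_ω} · (r, s)) D_ω^{k/2} / Q_ω(z, 1)^k`. -/
def term (k : ℕ) (ε : ℤˣ) (σ : K →+* ℝ) (r s : OnePoint ℚ) (ω : K) (z : ℂ_[p]) : ℂ_[p] :=
  (rmInter ε σ ω r s : ℂ_[p]) *
    (((posSqrt σ (formOf σ ω).disc : K) : ℂ_[p]) ^ k / (formOf σ ω).eval z ^ k)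

/-- `φ_τ`. -/
def phi (k : ℕ) (ε : ℤˣ) (σ : K →+* ℝ) (τ : K) (z : ℂ_[p]) : ℂ_[p] :=
  ∑' ω : SigmaZeroInfty p σ τ, term k ε σ ((0 : ℚ) : OnePoint ℚ) OnePoint.infty (ω : K) z

/-- `Φ_τ{r, s}`. -/
def Phi (k : ℕ) (ε : ℤˣ) (σ : K →+* ℝ) (τ : K) (r s : OnePoint ℚ) (z : ℂ_[p]) : ℂ_[p] :=
  ∑' ω : SigmaSet p σ τ r s, term k ε σ r s (ω : K) z

/-- The sum over `ω ∈ S` of the terms for `(r, s)` converges to `f`, uniformly on affinoids: for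
each affinoid subset `X` of the `p`-adic upper half plane, all but finitely many terms
have no pole in `X`, and the sum of the others converges uniformly on `X` (unconditionally). -/
def ConvergesOnAffinoids (k : ℕ) (ε : ℤˣ) (σ : K →+* ℝ) (S : Set K) (r s : OnePoint ℚ)
    (f : ℂ_[p] → ℂ_[p]) : Prop :=
  ∀ X : Set ℂ_[p], IsAffinoid p X → X ⊆ Hp p → ∃ F : Finset K, (F : Set K) ⊆ S ∧
    (∀ ω ∈ S, ω ∉ F → ∀ z ∈ X, (formOf σ ω).eval z ≠ 0) ∧
    HasSumUniformlyOn (fun (ω : (S \ (F : Set K) : Set K)) z => term k ε σ r s (ω : K) z)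
      (fun z => f z - ∑ ω ∈ F, term k ε σ r s ω z) X

end Series

end

end RMPeriod

open RMPeriod

namespace RMPeriod

/-! ### Intersection numbers of geodesics -/

/-! Convergence. A matrix in `Γ` changes discriminants only by powers of `p`, so the product of the
real and the `p`-adic absolute value of `D_ω` is constant on `Γτ` (`exists_pow_mul_disc`,
`abs_mul_norm_eq`). If the geodesic of `ω` meets `(r, s)`, then `Q_ω` takes values of opposite sign
at `r` and `s`, and only finitely many integral forms of bounded discriminant do so
(`finite_setOf_intForm`). Hence `D_ω` tends to `0` `p`-adically along `Σ_τ(r, s)`. A primitive form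
of small `p`-adic discriminant is close to a unit times the square of a linear form with rational
coefficients, up to factors of `2`, so it is bounded below on `HpLe p n`
(`IntForm.Primitive.le_norm_eval`). The terms therefore tend to `0` uniformly on `HpLe p n`, which
in an ultrametric setting is all that convergence requires. Every affinoid of the `p`-adic half
plane lies in some `HpLe p n`, by compactness of balls in `ℚ_p`.

Cocycle. Twice the intersection number is a difference of two signs, one depending on `r` and one on
`s` (`two_mul_interNumber`), so it is additive and `Γ`-invariant. It vanishes for `ω` outside
`Σ_τ(r, s)`, so every `Φ_τ{r, s}` may be summed over the whole orbit. The quotient of `√D_ω` by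
`Q_ω(z, 1)` is `(ω - ω') / ((z - ω)(z - ω'))`, which transforms with weight `2`. The cocycle
relations then hold term by term after `Γ` permutes the orbit. -/

/-- The quadratic form with roots `x` and `y`, evaluated at the homogeneous coordinates of `r`. -/
noncomputable def rootForm (x y : ℝ) (r : OnePoint ℝ) : ℝ :=
  ((homog r).1 - x * (homog r).2) * ((homog r).1 - y * (homog r).2)

theorem mem_geodesic_iff (x y : OnePoint ℝ) (z : UpperHalfPlane) :
    z ∈ geodesic x y ↔ (homog x).1 * (homog y).1 -
      ((homog x).1 * (homog y).2 + (homog x).2 * (homog y).1) * z.re +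
      (homog x).2 * (homog y).2 * (z.re ^ 2 + z.im ^ 2) = 0 := by
  rw [geodesic, Set.mem_ofPred_eq]
  apply Eq.congr_left
  simp
  ring

@[simp] theorem homog_coe (x : ℝ) : homog (x : OnePoint ℝ) = (x, 1) := rfl

@[simp] theorem homog_infty : homog OnePoint.infty = (1, 0) := rfl

/-- Two circles orthogonal to the real line have a vertical radical axis, which fixes `Re z`. The
first equation then gives the square of `Im z`, and its positivity is the sign condition. -/
theorem geodesic_inter_nonempty_iff {x y : ℝ} {r s : OnePoint ℝ}
    (hr : rootForm x y r ≠ 0) (hs : rootForm x y s ≠ 0) :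
    (geodesic x y ∩ geodesic r s).Nonempty ↔ rootForm x y r * rootForm x y s < 0 := by
  have hrs := mul_ne_zero hr hs
  simp only [rootForm] at *
  set r₁ := (homog r).1
  set r₂ := (homog r).2
  set s₁ := (homog s).1
  set s₂ := (homog s).2
  -- Eliminating `|z|²` from the two geodesic equations leaves `M * Re z = N`.
  set M : ℝ := r₁ * s₂ + r₂ * s₁ - r₂ * s₂ * (x + y) with hM
  set N : ℝ := r₁ * s₁ - r₂ * s₂ * (x * y) with hN
  have key : (r₁ - x * r₂) * (r₁ - y * r₂) * ((s₁ - x * s₂) * (s₁ - y * s₂)) =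
      (x * M - N) * (y * M - N) := by rw [hM, hN]; ring
  rw [key] at hrs ⊢
  constructor
  · rintro ⟨z, hz, hz'⟩
    rw [mem_geodesic_iff] at hz hz'
    simp only [homog_coe] at hz
    have h1 : N = z.re * M := by
      rw [hM, hN]
      linear_combination hz' - r₂ * s₂ * hz
    have h2 : (x * M - N) * (y * M - N) = -(M * z.im) ^ 2 := by
      rw [h1]
      linear_combination M ^ 2 * hz
    rw [h2] at hrs ⊢
    rcases lt_or_eq_of_le (neg_nonpos.mpr (sq_nonneg (M * z.im))) with h | h
    · exact h
    · exact absurd h hrs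
  · intro h
    have hM0 : M ≠ 0 := by
      intro h0
      rw [h0] at h
      nlinarith [sq_nonneg N]
    have hpos : 0 < -((x - N / M) * (y - N / M)) := by
      have : (x - N / M) * (y - N / M) = (x * M - N) * (y * M - N) / M ^ 2 := by field_simp
      rw [this, neg_pos]
      exact div_neg_of_neg_of_pos h (by positivity)
    refine ⟨⟨⟨N / M, √(-((x - N / M) * (y - N / M)))⟩, Real.sqrt_pos.mpr hpos⟩, ?_, ?_⟩
    · rw [mem_geodesic_iff]
      simp only [homog_coe, UpperHalfPlane.re, UpperHalfPlane.im]
      rw [Real.sq_sqrt hpos.le]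
      ring
    · rw [mem_geodesic_iff]
      simp only [UpperHalfPlane.re, UpperHalfPlane.im]
      rw [Real.sq_sqrt hpos.le]
      have : N / M * M = N := by field_simp
      change r₁ * s₁ - (r₁ * s₂ + r₂ * s₁) * (N / M) + r₂ * s₂ * _ = 0
      linear_combination (-1 : ℝ) * this

theorem cyc_coe_coe (x y : ℝ) (r : OnePoint ℝ) :
    cyc x r y = SignType.sign (rootForm x y r * (x - y)) := by
  simp only [cyc, bdet, rootForm, homog_coe]
  congr 2
  ring

/-- Both orientations are `±1`, and they differ exactly when the root form has opposite signs at `r`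
and `s`, that is, when the geodesics cross. Splitting the contributions of `r` and `s` makes
additivity and invariance linear. -/
theorem two_mul_interNumber (ε : ℤˣ) {x y : ℝ} {r s : OnePoint ℝ} (hxy : x ≠ y)
    (hr : rootForm x y r ≠ 0) (hs : rootForm x y s ≠ 0) :
    2 * interNumber ε x y r s = ε * (cyc x r y - cyc x s y) := by
  rw [interNumber, geodesic_inter_nonempty_iff hr hs, cyc_coe_coe, cyc_coe_coe]
  simp only [sign_mul]
  rcases lt_or_gt_of_ne hr with h1 | h1 <;> rcases lt_or_gt_of_ne hs with h2 | h2 <;>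
    rcases lt_or_gt_of_ne (sub_ne_zero.mpr hxy) with h3 | h3 <;>
    simp [h1, h2, h3, mul_pos_of_neg_of_neg, mul_neg_of_neg_of_pos, mul_neg_of_pos_of_neg,
      not_lt.mpr, le_of_lt] <;> ring

/-- Homogeneous coordinates of a point of `ℙ¹(ℚ)`. -/
def rhomog (r : OnePoint ℚ) : ℚ × ℚ := r.elim (1, 0) (fun t => (t, 1))

theorem homog_ratPoint (r : OnePoint ℚ) :
    homog (ratPoint r) = (((rhomog r).1 : ℝ), ((rhomog r).2 : ℝ)) := by
  cases r <;> simp [rhomog, ratPoint]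

/-- The scalar `l` absorbs the normalization of coordinates; it only enters later through its
square. -/
theorem rhomog_smul (γ : SL(2, ℚ)) (r : OnePoint ℚ) : ∃ l : ℚ, l ≠ 0 ∧
    γ 0 0 * (rhomog r).1 + γ 0 1 * (rhomog r).2 = l * (rhomog ((γ : GL (Fin 2) ℚ) • r)).1 ∧
    γ 1 0 * (rhomog r).1 + γ 1 1 * (rhomog r).2 = l * (rhomog ((γ : GL (Fin 2) ℚ) • r)).2 := by
  have hdet := γ.det_coe
  rw [Matrix.det_fin_two] at hdet
  cases r with
  | infty =>
    rw [OnePoint.smul_infty_eq_ite]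
    by_cases h : γ 1 0 = 0
    · refine ⟨γ 0 0, ?_, ?_⟩
      · intro h'
        simp [h, h'] at hdet
      · simp [h, rhomog]
    · refine ⟨γ 1 0, h, ?_⟩
      simp [h, rhomog]
      field_simp
  | coe t =>
    rw [OnePoint.smul_some_eq_ite]
    by_cases h : γ 1 0 * t + γ 1 1 = 0
    · refine ⟨γ 0 0 * t + γ 0 1, ?_, ?_⟩
      · intro h'
        have : (1 : ℚ) = 0 := by
          rw [← hdet]
          by_cases h10 : γ 1 0 = 0
          · simp_all
          · have : t = - γ 1 1 / γ 1 0 := by field_simp; linear_combination h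
            rw [this] at h'
            field_simp at h'
            linear_combination -h'
        exact one_ne_zero this
      · simp [h, rhomog]
    · refine ⟨γ 1 0 * t + γ 1 1, h, ?_⟩
      simp [h, rhomog, mul_div_cancel₀]

/-- The form with irrational roots does not vanish at rational points. -/
theorem rootForm_ratPoint_ne_zero {x y : ℝ} (hx : x ∉ Set.range ((↑) : ℚ → ℝ))
    (hy : y ∉ Set.range ((↑) : ℚ → ℝ)) (r : OnePoint ℚ) : rootForm x y (ratPoint r) ≠ 0 := by
  have key : ∀ z : ℝ, z ∉ Set.range ((↑) : ℚ → ℝ) →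
      ((rhomog r).1 : ℝ) - z * (rhomog r).2 ≠ 0 := by
    intro z hz h
    apply hz
    cases r with
    | infty => simp [rhomog] at h
    | coe t => exact ⟨t, by simpa [rhomog, sub_eq_zero] using h⟩
  rw [rootForm, homog_ratPoint]
  exact mul_ne_zero (key x hx) (key y hy)

theorem denom_ne_zero {F : Type*} [Field F] [CharZero F] (γ : SL(2, ℚ)) {z : F}
    (hz : z ∉ Set.range ((↑) : ℚ → F)) : (γ 1 0 : F) * z + (γ 1 1 : F) ≠ 0 := by
  intro h
  have hdet := γ.det_coe
  rw [Matrix.det_fin_two] at hdet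
  by_cases h10 : γ 1 0 = 0
  · simp only [h10, Rat.cast_zero, zero_mul, zero_add, Rat.cast_eq_zero] at h
    simp [h10, h] at hdet
  · apply hz
    refine ⟨-γ 1 1 / γ 1 0, ?_⟩
    have : (γ 1 0 : F) ≠ 0 := by exact_mod_cast h10
    push_cast
    field_simp
    linear_combination -h

theorem cast_det {F : Type*} [Field F] [CharZero F] (γ : SL(2, ℚ)) :
    (γ 0 0 : F) * γ 1 1 - γ 0 1 * γ 1 0 = 1 := by
  have hdet := γ.det_coe
  rw [Matrix.det_fin_two] at hdet
  exact_mod_cast congrArg ((↑) : ℚ → F) hdet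

/-- The number whose sign is `cyc` is multiplied by a nonzero square: `c x + d` and `c y + d` each
occur once in the root form and once in `x - y`, and `l` occurs twice. -/
theorem cyc_moebius (γ : SL(2, ℚ)) {x y : ℝ} (hx : x ∉ Set.range ((↑) : ℚ → ℝ))
    (hy : y ∉ Set.range ((↑) : ℚ → ℝ)) (r : OnePoint ℚ) :
    cyc (moebius γ x : ℝ) (ratPoint ((γ : GL (Fin 2) ℚ) • r)) (moebius γ y : ℝ) =
      cyc x (ratPoint r) y := by
  rw [cyc_coe_coe, cyc_coe_coe]
  obtain ⟨l, hl, h1, h2⟩ := rhomog_smul γ r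
  have hx' := denom_ne_zero γ hx
  have hy' := denom_ne_zero γ hy
  have hl' : (l : ℝ) ≠ 0 := by exact_mod_cast hl
  have hdet := cast_det (F := ℝ) γ
  have h1' := congrArg ((↑) : ℚ → ℝ) h1
  have h2' := congrArg ((↑) : ℚ → ℝ) h2
  push_cast at h1' h2'
  have hfac : ∀ z : ℝ, (γ 1 0 : ℝ) * z + (γ 1 1 : ℝ) ≠ 0 →
      (((rhomog ((γ : GL (Fin 2) ℚ) • r)).1 : ℝ) -
        moebius γ z * (rhomog ((γ : GL (Fin 2) ℚ) • r)).2) =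
      ((rhomog r).1 - z * (rhomog r).2) / (l * ((γ 1 0 : ℝ) * z + (γ 1 1 : ℝ))) := by
    intro z hz
    rw [moebius, eq_div_iff (mul_ne_zero hl' hz), div_mul_eq_mul_div,
      sub_div' hz, div_mul_eq_mul_div, div_eq_iff hz]
    linear_combination (γ 1 0 * z + γ 1 1 : ℝ) * ((-(γ 1 0 * z + γ 1 1)) * h1' +
      (γ 0 0 * z + γ 0 1) * h2' + ((rhomog r).1 - z * (rhomog r).2) * hdet)
  have hsub : (moebius γ x : ℝ) - moebius γ y =
      (x - y) / (((γ 1 0 : ℝ) * x + (γ 1 1 : ℝ)) * ((γ 1 0 : ℝ) * y + (γ 1 1 : ℝ))) := by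
    rw [moebius, moebius, div_sub_div _ _ hx' hy']
    congr 1
    linear_combination (x - y) * hdet
  have : rootForm (moebius γ x) (moebius γ y) (ratPoint ((γ : GL (Fin 2) ℚ) • r)) *
      (moebius γ x - moebius γ y) = rootForm x y (ratPoint r) * (x - y) *
      ((l * ((γ 1 0 : ℝ) * x + (γ 1 1 : ℝ)) * ((γ 1 0 : ℝ) * y + (γ 1 1 : ℝ)))⁻¹) ^ 2 := by
    rw [rootForm, rootForm, homog_ratPoint, homog_ratPoint, hfac x hx', hfac y hy', hsub]
    field_simp
  rw [this, sign_mul]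
  have hpos : 0 < ((l * ((γ 1 0 : ℝ) * x + (γ 1 1 : ℝ)) * ((γ 1 0 : ℝ) * y + (γ 1 1 : ℝ)))⁻¹) ^ 2 := by
    positivity
  rw [sign_pos hpos, mul_one]

/-! ### Moebius transformations and conjugation in a quadratic field -/

section MoebiusField

variable {F : Type*} [Field F] [CharZero F]

theorem map_moebius {L : Type*} [Field L] [CharZero L] (f : F →+* L) (γ : SL(2, ℚ)) (z : F) :
    f (moebius γ z) = moebius γ (f z) := by
  simp [moebius, map_ratCast]

theorem moebius_one {F : Type*} [Field F] (z : F) : moebius 1 z = z := by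
  simp [moebius]

theorem moebius_mul (γ δ : SL(2, ℚ)) {z : F} (hz : z ∉ Set.range ((↑) : ℚ → F)) :
    moebius (γ * δ) z = moebius γ (moebius δ z) := by
  have h1 := denom_ne_zero (γ * δ) hz
  have h2 := denom_ne_zero δ hz
  have h3 : (γ 1 0 : F) * moebius δ z + γ 1 1 = (((γ * δ) 1 0 : ℚ) * z + ((γ * δ) 1 1 : ℚ)) /
      ((δ 1 0 : F) * z + δ 1 1) := by
    rw [eq_div_iff h2, moebius, ← mul_div_assoc, div_add' _ _ _ h2, div_mul_cancel₀ _ h2]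
    simp only [Matrix.SpecialLinearGroup.coe_mul, Matrix.mul_apply, Fin.sum_univ_two]
    push_cast
    ring
  have h4 : (γ 0 0 : F) * moebius δ z + γ 0 1 = (((γ * δ) 0 0 : ℚ) * z + ((γ * δ) 0 1 : ℚ)) /
      ((δ 1 0 : F) * z + δ 1 1) := by
    rw [eq_div_iff h2, moebius, ← mul_div_assoc, div_add' _ _ _ h2, div_mul_cancel₀ _ h2]
    simp only [Matrix.SpecialLinearGroup.coe_mul, Matrix.mul_apply, Fin.sum_univ_two]
    push_cast
    ring
  rw [moebius, moebius, h3, h4, div_div_div_cancel_right₀ h2]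

theorem moebius_notMem_range (γ : SL(2, ℚ)) {z : F} (hz : z ∉ Set.range ((↑) : ℚ → F)) :
    moebius γ z ∉ Set.range ((↑) : ℚ → F) := by
  rintro ⟨q, hq⟩
  apply hz
  refine ⟨moebius γ⁻¹ q, ?_⟩
  have : ((moebius γ⁻¹ q : ℚ) : F) = moebius γ⁻¹ (q : F) := map_moebius (Rat.castHom F) γ⁻¹ q
  rw [this, hq, ← moebius_mul _ _ hz, inv_mul_cancel, moebius_one]

theorem moebius_sub_moebius (γ : SL(2, ℚ)) {x y : F} (hx : x ∉ Set.range ((↑) : ℚ → F))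
    (hy : y ∉ Set.range ((↑) : ℚ → F)) : moebius γ x - moebius γ y =
      (x - y) / (((γ 1 0 : F) * x + γ 1 1) * ((γ 1 0 : F) * y + γ 1 1)) := by
  rw [moebius, moebius, div_sub_div _ _ (denom_ne_zero γ hx) (denom_ne_zero γ hy)]
  congr 1
  linear_combination (x - y) * cast_det (F := F) γ

theorem map_notMem_range {F L : Type*} [Field F] [Field L] (f : F →+* L) {z : F}
    (hz : z ∉ Set.range ((↑) : ℚ → F)) : f z ∉ Set.range ((↑) : ℚ → L) := by
  rintro ⟨q, hq⟩
  refine hz ⟨q, f.injective ?_⟩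
  rw [map_ratCast, hq]

end MoebiusField

section Quad

variable {K : Type*} [Field K] [CharZero K]

/-- The extension is Galois with group `{1, c}`, so the trace of `x` is `x + c x`. -/
theorem exists_algEquiv_galConj (hK : Module.finrank ℚ K = 2) :
    ∃ c : K ≃ₐ[ℚ] K, (∀ x, galConj x = c x) ∧
      ∀ x, c x = x → x ∈ Set.range ((↑) : ℚ → K) := by
  have : Algebra.IsQuadraticExtension ℚ K := ⟨hK⟩
  have hcard : Nat.card (K ≃ₐ[ℚ] K) = 2 := by rw [IsGalois.card_aut_eq_finrank, hK]
  have : Finite (K ≃ₐ[ℚ] K) := Nat.finite_of_card_ne_zero (by omega)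
  obtain ⟨c, hc, huniv⟩ := (Nat.card_eq_two_iff' (1 : K ≃ₐ[ℚ] K)).mp hcard
  have huniv' : ∀ g : K ≃ₐ[ℚ] K, g = 1 ∨ g = c := fun g => by
    by_cases hg : g = 1
    · exact Or.inl hg
    · exact Or.inr (huniv g hg)
  refine ⟨c, fun x => ?_, fun x hx => ?_⟩
  · classical
    rw [galConj, trace_eq_sum_automorphisms]
    have : (Finset.univ : Finset (K ≃ₐ[ℚ] K)) = {1, c} := by
      ext g
      simpa using huniv' g
    rw [this, Finset.sum_pair (Ne.symm hc)]
    simp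
  · obtain ⟨q, hq⟩ := (IsGalois.mem_range_algebraMap_iff_fixed (F := ℚ) x).mpr (by
      intro f
      rcases huniv' f with rfl | rfl
      · rfl
      · exact hx)
    exact ⟨q, by rw [← hq, eq_ratCast]⟩

theorem galConj_moebius (hK : Module.finrank ℚ K = 2) (γ : SL(2, ℚ)) (ω : K) :
    galConj (moebius γ ω) = moebius γ (galConj ω) := by
  obtain ⟨c, hc, -⟩ := exists_algEquiv_galConj hK
  rw [hc, hc]
  exact map_moebius (c : K →+* K) γ ω

theorem galConj_notMem_range (hK : Module.finrank ℚ K = 2) {ω : K}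
    (hω : ω ∉ Set.range ((↑) : ℚ → K)) : galConj ω ∉ Set.range ((↑) : ℚ → K) := by
  obtain ⟨c, hc, -⟩ := exists_algEquiv_galConj hK
  rw [hc]
  exact map_notMem_range (c : K →+* K) hω

theorem galConj_ne_self (hK : Module.finrank ℚ K = 2) {ω : K}
    (hω : ω ∉ Set.range ((↑) : ℚ → K)) : galConj ω ≠ ω := by
  obtain ⟨c, hc, h⟩ := exists_algEquiv_galConj hK
  rw [hc]
  exact fun h' => hω (h _ h')

theorem orbit_notMem_range {p : ℕ} {τ : K} (hτ : τ ∉ Set.range ((↑) : ℚ → K)) {ω : K}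
    (hω : ω ∈ orbit p τ) : ω ∉ Set.range ((↑) : ℚ → K) := by
  obtain ⟨γ, -, rfl⟩ := hω
  exact moebius_notMem_range γ hτ

theorem moebius_mem_orbit {p : ℕ} {τ : K} (hτ : τ ∉ Set.range ((↑) : ℚ → K)) {ω : K}
    (hω : ω ∈ orbit p τ) {γ : SL(2, ℚ)} (hγ : γ ∈ Gam p) : moebius γ ω ∈ orbit p τ := by
  obtain ⟨δ, hδ, rfl⟩ := hω
  exact ⟨γ * δ, mul_mem hγ hδ, (moebius_mul _ _ hτ).symm⟩

theorem orbit_moebius {p : ℕ} {τ : K} (hτ : τ ∉ Set.range ((↑) : ℚ → K))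
    {γ : SL(2, ℚ)} (hγ : γ ∈ Gam p) : orbit p (moebius γ τ) = orbit p τ := by
  ext ω
  constructor
  · rintro ⟨δ, hδ, rfl⟩
    exact ⟨δ * γ, mul_mem hδ hγ, (moebius_mul _ _ hτ).symm⟩
  · rintro ⟨δ, hδ, rfl⟩
    refine ⟨δ * γ⁻¹, mul_mem hδ (inv_mem hγ), ?_⟩
    rw [← moebius_mul _ _ hτ, inv_mul_cancel_right]

/-- An element of `Γ` permutes each orbit. -/
noncomputable def orbitEquiv {p : ℕ} {τ : K} (hτ : τ ∉ Set.range ((↑) : ℚ → K))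
    {γ : SL(2, ℚ)} (hγ : γ ∈ Gam p) : orbit p τ ≃ orbit p τ where
  toFun ω := ⟨moebius γ ω, moebius_mem_orbit hτ ω.2 hγ⟩
  invFun ω := ⟨moebius γ⁻¹ ω, moebius_mem_orbit hτ ω.2 (inv_mem hγ)⟩
  left_inv ω := by
    ext
    simp only
    rw [← moebius_mul _ _ (orbit_notMem_range hτ ω.2), inv_mul_cancel, moebius_one]
  right_inv ω := by
    ext
    simp only
    rw [← moebius_mul _ _ (orbit_notMem_range hτ ω.2), mul_inv_cancel, moebius_one]

/-! ### Intersection numbers attached to quadratic irrationalities -/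

theorem rootForm_ne_zero (hK : Module.finrank ℚ K = 2) (σ : K →+* ℝ) {ω : K}
    (hω : ω ∉ Set.range ((↑) : ℚ → K)) (r : OnePoint ℚ) :
    rootForm (σ ω) (σ (galConj ω)) (ratPoint r) ≠ 0 :=
  rootForm_ratPoint_ne_zero (map_notMem_range σ hω)
    (map_notMem_range σ (galConj_notMem_range hK hω)) r

theorem two_mul_rmInter (hK : Module.finrank ℚ K = 2) (σ : K →+* ℝ) {ω : K}
    (hω : ω ∉ Set.range ((↑) : ℚ → K)) (ε : ℤˣ) (r s : OnePoint ℚ) : 2 * rmInter ε σ ω r s =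
    ε * (cyc (σ ω) (ratPoint r) (σ (galConj ω)) - cyc (σ ω) (ratPoint s) (σ (galConj ω))) :=
  two_mul_interNumber ε (fun h => galConj_ne_self hK hω (σ.injective h.symm))
    (rootForm_ne_zero hK σ hω r) (rootForm_ne_zero hK σ hω s)

theorem rmInter_add (hK : Module.finrank ℚ K = 2) (σ : K →+* ℝ) {ω : K}
    (hω : ω ∉ Set.range ((↑) : ℚ → K)) (ε : ℤˣ) (r s t : OnePoint ℚ) :
    rmInter ε σ ω r s + rmInter ε σ ω s t = rmInter ε σ ω r t := by
  have h1 := two_mul_rmInter hK σ hω ε r s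
  have h2 := two_mul_rmInter hK σ hω ε s t
  have h3 := two_mul_rmInter hK σ hω ε r t
  linarith

theorem rmInter_swap (hK : Module.finrank ℚ K = 2) (σ : K →+* ℝ) {ω : K}
    (hω : ω ∉ Set.range ((↑) : ℚ → K)) (ε : ℤˣ) (r s : OnePoint ℚ) :
    rmInter ε σ ω r s = -rmInter ε σ ω s r := by
  have h1 := two_mul_rmInter hK σ hω ε r s
  have h2 := two_mul_rmInter hK σ hω ε s r
  linarith

theorem rmInter_moebius (hK : Module.finrank ℚ K = 2) (σ : K →+* ℝ) {ω : K}
    (hω : ω ∉ Set.range ((↑) : ℚ → K)) (ε : ℤˣ) (γ : SL(2, ℚ)) (r s : OnePoint ℚ) :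
    rmInter ε σ (moebius γ ω) ((γ : GL (Fin 2) ℚ) • r) ((γ : GL (Fin 2) ℚ) • s) =
      rmInter ε σ ω r s := by
  have h1 := two_mul_rmInter hK σ hω ε r s
  have h2 := two_mul_rmInter hK σ (moebius_notMem_range γ hω) ε ((γ : GL (Fin 2) ℚ) • r)
    ((γ : GL (Fin 2) ℚ) • s)
  have hx := map_notMem_range σ hω
  have hy := map_notMem_range σ (galConj_notMem_range hK hω)
  rw [galConj_moebius hK, map_moebius, map_moebius, cyc_moebius γ hx hy,
    cyc_moebius γ hx hy] at h2
  linarith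

theorem geodesic_zero_infty_iff (hK : Module.finrank ℚ K = 2) (σ : K →+* ℝ) {ω : K}
    (hω : ω ∉ Set.range ((↑) : ℚ → K)) :
    (geodesic (σ ω : OnePoint ℝ) (σ (galConj ω) : OnePoint ℝ) ∩
      geodesic (ratPoint ((0 : ℚ) : OnePoint ℚ)) (ratPoint OnePoint.infty)).Nonempty ↔
      σ ω * σ (galConj ω) < 0 := by
  rw [geodesic_inter_nonempty_iff (rootForm_ne_zero hK σ hω _) (rootForm_ne_zero hK σ hω _)]
  simp [rootForm, homog_ratPoint, rhomog]

theorem rmInter_eq_zero {p : ℕ} {τ : K} (ε : ℤˣ) (σ : K →+* ℝ) {ω : K} (hω : ω ∈ orbit p τ)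
    {r s : OnePoint ℚ} (h : ω ∉ SigmaSet p σ τ r s) : rmInter ε σ ω r s = 0 := by
  rw [rmInter, interNumber, if_neg]
  exact fun h' => h ⟨hω, h'⟩

theorem sigmaSet_zero_infty (hK : Module.finrank ℚ K = 2) (p : ℕ) (σ : K →+* ℝ) {τ : K}
    (hτ : τ ∉ Set.range ((↑) : ℚ → K)) :
    SigmaSet p σ τ ((0 : ℚ) : OnePoint ℚ) OnePoint.infty = SigmaZeroInfty p σ τ := by
  ext ω
  exact and_congr_right fun hω => geodesic_zero_infty_iff hK σ (orbit_notMem_range hτ hω)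

end Quad

/-! ### The form attached to a quadratic irrationality -/

section Forms

variable {K : Type*} [Field K] [CharZero K]

theorem isFormOf_formOf (hK : Module.finrank ℚ K = 2) (σ : K →+* ℝ) {ω : K}
    (hω : ω ∉ Set.range ((↑) : ℚ → K)) : IsFormOf σ ω (formOf σ ω) := by
  have h : ∃ Q, IsFormOf σ ω Q := (existsUnique_isFormOf hK σ ω (by
    rintro ⟨q, hq⟩
    exact hω ⟨q, by rw [← hq, eq_ratCast]⟩)).exists
  rw [formOf, dif_pos h]
  exact h.choose_spec

theorem eq_zero_of_mul_add_eq_zero {ω : K} (hω : ω ∉ Set.range ((↑) : ℚ → K)) {a b : ℤ}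
    (h : (a : K) * ω + b = 0) : a = 0 ∧ b = 0 := by
  by_cases ha : a = 0
  · subst ha
    exact ⟨rfl, by simpa using h⟩
  · refine absurd ⟨-(b : ℚ) / a, ?_⟩ hω
    have ha' : (a : K) ≠ 0 := by exact_mod_cast ha
    push_cast
    field_simp
    linear_combination -h

theorem IntForm.Primitive.a_ne_zero {ω : K} (hω : ω ∉ Set.range ((↑) : ℚ → K)) {Q : IntForm}
    (hQ : Q.Primitive) (h0 : Q.eval ω = 0) : Q.a ≠ 0 := by
  intro ha
  simp only [IntForm.eval, ha, Int.cast_zero, zero_mul, zero_add] at h0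
  obtain ⟨hb, hc⟩ := eq_zero_of_mul_add_eq_zero hω h0
  simp [IntForm.Primitive, ha, hb, hc] at hQ

/-- An integral form vanishing at an irrational root of a primitive form is a multiple of it. -/
theorem IntForm.Primitive.exists_mul {ω : K} (hω : ω ∉ Set.range ((↑) : ℚ → K)) {Q R : IntForm}
    (hQ : Q.Primitive) (hQ0 : Q.eval ω = 0) (hR0 : R.eval ω = 0) :
    ∃ m : ℤ, R.a = m * Q.a ∧ R.b = m * Q.b ∧ R.c = m * Q.c := by
  have ha := hQ.a_ne_zero hω hQ0
  obtain ⟨e1, e2⟩ := eq_zero_of_mul_add_eq_zero hω (a := Q.a * R.b - R.a * Q.b)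
    (b := Q.a * R.c - R.a * Q.c) (by
      simp only [IntForm.eval] at hQ0 hR0
      push_cast
      linear_combination (Q.a : K) * hR0 - (R.a : K) * hQ0)
  have h1 := Int.gcd_eq_gcd_ab (Int.gcd Q.a Q.b) Q.c
  rw [show Int.gcd (Int.gcd Q.a Q.b) Q.c = 1 from hQ, Int.gcd_eq_gcd_ab Q.a Q.b] at h1
  set x := Int.gcdA Q.a Q.b
  set y := Int.gcdB Q.a Q.b
  set t := Int.gcdA (Q.a * x + Q.b * y) Q.c
  set z := Int.gcdB (Q.a * x + Q.b * y) Q.c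
  -- The multiplier is the Bézout combination that equals `1` on the coefficients of `Q`, evaluated
  -- on those of `R`.
  have hm : R.a = (t * x * R.a + t * y * R.b + z * R.c) * Q.a := by
    push_cast at h1
    linear_combination R.a * h1 - t * y * e1 - z * e2
  refine ⟨t * x * R.a + t * y * R.b + z * R.c, hm, ?_, ?_⟩ <;> apply mul_left_cancel₀ ha
  · linear_combination e1 + Q.b * hm
  · linear_combination e2 + Q.c * hm

theorem formOf_a_ne_zero (hK : Module.finrank ℚ K = 2) (σ : K →+* ℝ) {ω : K}
    (hω : ω ∉ Set.range ((↑) : ℚ → K)) : (formOf σ ω).a ≠ 0 :=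
  (isFormOf_formOf hK σ hω).1.a_ne_zero hω (isFormOf_formOf hK σ hω).2.1

theorem formOf_vieta (hK : Module.finrank ℚ K = 2) (σ : K →+* ℝ) {ω : K}
    (hω : ω ∉ Set.range ((↑) : ℚ → K)) : ((formOf σ ω).b : K) = -(formOf σ ω).a * (ω + galConj ω) ∧
    ((formOf σ ω).c : K) = (formOf σ ω).a * (ω * galConj ω) := by
  obtain ⟨c, hc, -⟩ := exists_algEquiv_galConj hK
  have hQ := (isFormOf_formOf hK σ hω).2.1
  have hne := sub_ne_zero.mpr (galConj_ne_self hK hω)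
  have hQ' : (formOf σ ω).eval (galConj ω) = 0 := by
    have := congrArg c hQ
    simpa [IntForm.eval, hc] using this
  simp only [IntForm.eval] at hQ hQ'
  have hb : ((formOf σ ω).b : K) = -(formOf σ ω).a * (ω + galConj ω) := by
    apply mul_left_cancel₀ hne
    linear_combination hQ' - hQ
  refine ⟨hb, ?_⟩
  rw [hb] at hQ
  linear_combination hQ

theorem map_formOf_eval (hK : Module.finrank ℚ K = 2) (σ : K →+* ℝ) {ω : K}
    (hω : ω ∉ Set.range ((↑) : ℚ → K)) {L : Type*} [Field L] (f : K →+* L) (z : L) :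
    (formOf σ ω).eval z = (formOf σ ω).a * ((z - f ω) * (z - f (galConj ω))) := by
  obtain ⟨hb, hc⟩ := formOf_vieta hK σ hω
  have hb' := congrArg f hb
  have hc' := congrArg f hc
  simp only [map_intCast, map_mul, map_neg, map_add] at hb' hc'
  rw [IntForm.eval, hb', hc']
  ring

/-- Here the convention that `ω` is the first root fixes the sign. The leading coefficient will
cancel against that of `Q_ω(z, 1)`. -/
theorem posSqrt_disc (hK : Module.finrank ℚ K = 2) (σ : K →+* ℝ) {ω : K}
    (hω : ω ∉ Set.range ((↑) : ℚ → K)) : posSqrt σ (formOf σ ω).disc = (formOf σ ω).a *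
    (ω - galConj ω) := by
  obtain ⟨-, -, s, hs2, hs, hsω⟩ := isFormOf_formOf hK σ hω
  have ha : ((formOf σ ω).a : K) ≠ 0 := by exact_mod_cast formOf_a_ne_zero hK σ hω
  have h : ∃ s : K, s ^ 2 = ((formOf σ ω).disc : K) ∧ 0 < σ s := ⟨s, hs2, hs⟩
  have hpos : posSqrt σ (formOf σ ω).disc = s := by
    rw [posSqrt, dif_pos h]
    obtain ⟨h1, h2⟩ := h.choose_spec
    rcases sq_eq_sq_iff_eq_or_eq_neg.mp (h1.trans hs2.symm) with h3 | h3
    · exact h3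
    · rw [h3, map_neg] at h2
      linarith
  have hsω' : s = 2 * (formOf σ ω).a * ω + (formOf σ ω).b := by
    rw [eq_div_iff (mul_ne_zero two_ne_zero ha)] at hsω
    linear_combination -hsω
  rw [hpos, hsω', (formOf_vieta hK σ hω).1]
  ring

theorem formOf_disc (hK : Module.finrank ℚ K = 2) (σ : K →+* ℝ) {ω : K}
    (hω : ω ∉ Set.range ((↑) : ℚ → K)) : ((formOf σ ω).disc : K) =
    ((formOf σ ω).a * (ω - galConj ω)) ^ 2 := by
  obtain ⟨hb, hc⟩ := formOf_vieta hK σ hω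
  rw [IntForm.disc]
  push_cast
  rw [hb, hc]
  ring

theorem formOf_disc_ne_zero (hK : Module.finrank ℚ K = 2) (σ : K →+* ℝ) {ω : K}
    (hω : ω ∉ Set.range ((↑) : ℚ → K)) : (formOf σ ω).disc ≠ 0 := by
  have h := formOf_disc hK σ hω
  have ha : ((formOf σ ω).a : K) ≠ 0 := by exact_mod_cast formOf_a_ne_zero hK σ hω
  have : ((formOf σ ω).disc : K) ≠ 0 := by
    rw [h]
    exact pow_ne_zero _ (mul_ne_zero ha (sub_ne_zero.mpr (galConj_ne_self hK hω).symm))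
  exact_mod_cast this

theorem eq_of_formOf_eq (hK : Module.finrank ℚ K = 2) (σ : K →+* ℝ) {ω : K}
    (hω : ω ∉ Set.range ((↑) : ℚ → K)) {ω' : K} (hω' : ω' ∉ Set.range ((↑) : ℚ → K))
    (h : formOf σ ω = formOf σ ω') : ω = ω' := by
  have h1 := posSqrt_disc hK σ hω
  have h2 := posSqrt_disc hK σ hω'
  have h3 := (formOf_vieta hK σ hω).1
  have h4 := (formOf_vieta hK σ hω').1
  have ha : ((formOf σ ω').a : K) ≠ 0 := by exact_mod_cast formOf_a_ne_zero hK σ hω'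
  rw [h] at h1 h3
  apply mul_left_cancel₀ (mul_ne_zero two_ne_zero ha)
  linear_combination h2 - h1 + h3 - h4

/-! ### Discriminants along an orbit -/

/-- All larger exponents are allowed so that one power of `p` can serve the four entries of a
matrix. -/
theorem exists_mul_pow_eq_int {p : ℕ} (hp : p ≠ 0) {x : ℚ} (hx : x ∈ ZInv p) :
    ∃ N : ℕ, ∀ M, N ≤ M → ∃ m : ℤ, x * p ^ M = m := by
  suffices ∃ N : ℕ, ∃ m : ℤ, x * p ^ N = m by
    obtain ⟨N, m, h⟩ := this
    refine ⟨N, fun M hM => ⟨m * p ^ (M - N), ?_⟩⟩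
    push_cast
    rw [← h, mul_assoc, ← pow_add, Nat.add_sub_cancel' hM]
  have hp' : (p : ℚ) ≠ 0 := by exact_mod_cast hp
  induction hx using Algebra.adjoin_induction with
  | mem x hx =>
    rw [Set.mem_singleton_iff] at hx
    exact ⟨1, 1, by simp [hx, hp']⟩
  | algebraMap m => exact ⟨0, m, by simp⟩
  | add x y _ _ hx hy =>
    obtain ⟨N, m, h⟩ := hx
    obtain ⟨N', m', h'⟩ := hy
    refine ⟨N + N', m * p ^ N' + m' * p ^ N, ?_⟩
    push_cast
    rw [← h, ← h']
    ring
  | mul x y _ _ hx hy =>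
    obtain ⟨N, m, h⟩ := hx
    obtain ⟨N', m', h'⟩ := hy
    refine ⟨N + N', m * m', ?_⟩
    push_cast
    rw [← h, ← h']
    ring

theorem exists_pow_mul_entries {p : ℕ} (hp : p ≠ 0) {γ : SL(2, ℚ)} (hγ : γ ∈ Gam p) :
    ∃ (N : ℕ) (g : Fin 2 → Fin 2 → ℤ), ∀ i j, γ i j * p ^ N = g i j := by
  obtain ⟨δ, rfl⟩ := hγ
  choose N hN using fun i j => exists_mul_pow_eq_int hp (δ i j).2
  have hle : ∀ i j, N i j ≤ ∑ i, ∑ j, N i j := fun i j =>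
    (Finset.single_le_sum (f := fun j => N i j) (fun _ _ => Nat.zero_le _) (Finset.mem_univ j)).trans
      (Finset.single_le_sum (f := fun i => ∑ j, N i j) (fun _ _ => Nat.zero_le _)
        (Finset.mem_univ i))
  choose g hg using fun i j => hN i j _ (hle i j)
  exact ⟨_, g, hg⟩

/-- Scaling `γ` by `p ^ N` gives an integral matrix of determinant `p ^ (2 * N)`. Pulling back the
form of `γτ` by it yields an integral form `R` vanishing at `τ`, hence `m` times the form of `τ`;
then compare discriminants. -/
theorem exists_sq_mul_disc (hK : Module.finrank ℚ K = 2) (σ : K →+* ℝ) {p : ℕ} (hp : p ≠ 0)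
    {τ : K} (hτ : τ ∉ Set.range ((↑) : ℚ → K)) {γ : SL(2, ℚ)} (hγ : γ ∈ Gam p) :
    ∃ (N : ℕ) (m : ℤ), (p : ℤ) ^ N * (formOf σ (moebius γ τ)).disc =
      m ^ 2 * (formOf σ τ).disc := by
  obtain ⟨N, g, hg⟩ := exists_pow_mul_entries hp hγ
  set Q := formOf σ (moebius γ τ) with hQ
  have hω := moebius_notMem_range γ hτ
  have hQ0 := (isFormOf_formOf hK σ hω).2.1
  rw [← hQ] at hQ0
  have hp' : (p : K) ≠ 0 := by exact_mod_cast hp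
  have hgK : ∀ i j, (g i j : K) = γ i j * p ^ N := fun i j => by
    have := congrArg ((↑) : ℚ → K) (hg i j)
    push_cast at this
    exact this.symm
  let R : IntForm := ⟨Q.a * g 0 0 ^ 2 + Q.b * g 0 0 * g 1 0 + Q.c * g 1 0 ^ 2,
    2 * Q.a * g 0 0 * g 0 1 + Q.b * (g 0 0 * g 1 1 + g 0 1 * g 1 0) + 2 * Q.c * g 1 0 * g 1 1,
    Q.a * g 0 1 ^ 2 + Q.b * g 0 1 * g 1 1 + Q.c * g 1 1 ^ 2⟩
  have hden := denom_ne_zero γ hτ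
  have hR0 : R.eval τ = 0 := by
    have h1 : (γ 0 0 : K) * τ + γ 0 1 = moebius γ τ * ((γ 1 0 : K) * τ + γ 1 1) := by
      rw [moebius, div_mul_cancel₀ _ hden]
    have h2 : (g 0 0 : K) * τ + g 0 1 = moebius γ τ * ((g 1 0 : K) * τ + g 1 1) := by
      simp only [hgK]
      linear_combination (p : K) ^ N * h1
    have h3 : R.eval τ = ((g 1 0 : K) * τ + g 1 1) ^ 2 * Q.eval (moebius γ τ) := by
      have : R.eval τ = Q.a * ((g 0 0 : K) * τ + g 0 1) ^ 2 +
          Q.b * ((g 0 0 : K) * τ + g 0 1) * ((g 1 0 : K) * τ + g 1 1) +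
          Q.c * ((g 1 0 : K) * τ + g 1 1) ^ 2 := by
        simp only [IntForm.eval, R]
        push_cast
        ring
      rw [this, h2, IntForm.eval]
      ring
    rw [h3, hQ0, mul_zero]
  obtain ⟨hP, hP0, -⟩ := isFormOf_formOf hK σ hτ
  obtain ⟨m, ha, hb, hc⟩ := hP.exists_mul hτ hP0 hR0
  refine ⟨4 * N, m, ?_⟩
  have hdet : (g 0 0 * g 1 1 - g 0 1 * g 1 0 : ℤ) = p ^ (2 * N) := by
    have h := cast_det (F := ℚ) γ
    have : ((g 0 0 * g 1 1 - g 0 1 * g 1 0 : ℤ) : ℚ) = p ^ (2 * N) := by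
      push_cast
      rw [← hg, ← hg, ← hg, ← hg]
      simp only [Rat.cast_id] at h
      linear_combination (p : ℚ) ^ (2 * N) * h
    exact_mod_cast this
  have hRd : R.disc = (p : ℤ) ^ (4 * N) * Q.disc := by
    have : R.disc = (g 0 0 * g 1 1 - g 0 1 * g 1 0) ^ 2 * Q.disc := by
      simp only [IntForm.disc, R]
      ring
    rw [this, hdet]
    ring
  rw [← hRd, IntForm.disc, ha, hb, hc, IntForm.disc]
  ring

/-- Discriminants along a `Γ`-orbit agree up to powers of `p`. -/
theorem exists_pow_mul_disc (hK : Module.finrank ℚ K = 2) (σ : K →+* ℝ) {p : ℕ} (hp : p.Prime)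
    {τ : K} (hτ : τ ∉ Set.range ((↑) : ℚ → K)) {ω : K} (hω : ω ∈ orbit p τ) :
    ∃ m n : ℕ, (p : ℤ) ^ m * (formOf σ ω).disc = (p : ℤ) ^ n * (formOf σ τ).disc := by
  have hω' := orbit_notMem_range hτ hω
  obtain ⟨γ, hγ, rfl⟩ := hω
  obtain ⟨N, m, h⟩ := exists_sq_mul_disc hK σ hp.ne_zero hτ hγ
  obtain ⟨N', m', h'⟩ := exists_sq_mul_disc hK σ hp.ne_zero hω' (inv_mem hγ)
  rw [← moebius_mul _ _ hτ, inv_mul_cancel, moebius_one] at h'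
  have h0 := formOf_disc_ne_zero hK σ hτ
  have h1 := formOf_disc_ne_zero hK σ hω'
  -- Going to `γτ` and back by `γ⁻¹` shows that `m` divides a power of `p`, so `m ^ 2` is itself a
  -- power of `p`.
  have h2 : (m * m') ^ 2 = (p : ℤ) ^ (N + N') := by
    apply mul_right_cancel₀ (mul_ne_zero h0 h1)
    rw [pow_add]
    linear_combination (-(p : ℤ) ^ N' * (formOf σ τ).disc) * h - m ^ 2 * (formOf σ τ).disc * h'
  have h3 : m.natAbs ∣ p ^ (N + N') := by
    refine ⟨m.natAbs * m'.natAbs ^ 2, ?_⟩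
    have := congrArg Int.natAbs h2
    simp only [Int.natAbs_pow, Int.natAbs_mul, Int.natAbs_natCast] at this
    rw [← this]
    ring
  obtain ⟨i, -, hi⟩ := (Nat.dvd_prime_pow hp).mp h3
  refine ⟨N, i * 2, ?_⟩
  rw [h, ← Int.natAbs_sq m, hi]
  push_cast
  ring

/-! ### Finiteness -/

/-- In the basis `(u, v)`, `(u', v')` the form has coefficients `α`, `η`, `β` and discriminant `η ^
2 - 4 * α * β`. When `α * β < 0` both summands are nonnegative, so bounding the discriminant bounds
all three coefficients. -/
theorem finite_setOf_intForm {u v u' v' : ℤ} (hd : u * v' - u' * v ≠ 0) (N : ℤ) :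
    {Q : IntForm | |Q.disc| ≤ N ∧ (Q.a * u ^ 2 + Q.b * u * v + Q.c * v ^ 2) *
      (Q.a * u' ^ 2 + Q.b * u' * v' + Q.c * v' ^ 2) < 0}.Finite := by
  set M := N * (u * v' - u' * v) ^ 2 with hM
  let f : IntForm → ℤ × ℤ × ℤ := fun Q => (Q.a * u ^ 2 + Q.b * u * v + Q.c * v ^ 2,
    Q.a * u' ^ 2 + Q.b * u' * v' + Q.c * v' ^ 2,
    2 * Q.a * u * u' + Q.b * (u * v' + u' * v) + 2 * Q.c * v * v')
  have hf : Function.Injective f := by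
    intro Q R h
    simp only [f, Prod.mk.injEq] at h
    obtain ⟨h1, h2, h3⟩ := h
    have hd2 := pow_ne_zero 2 hd
    ext <;> apply mul_left_cancel₀ hd2
    · linear_combination v' ^ 2 * h1 - v * v' * h3 + v ^ 2 * h2
    · linear_combination -2 * u' * v' * h1 + (u * v' + u' * v) * h3 - 2 * u * v * h2
    · linear_combination u' ^ 2 * h1 - u * u' * h3 + u ^ 2 * h2
  refine Set.Finite.subset (((Set.finite_Icc (-M) M).prod
    ((Set.finite_Icc (-M) M).prod (Set.finite_Icc (-M) M))).preimage hf.injOn) ?_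
  rintro Q ⟨hQ, hneg⟩
  set α := Q.a * u ^ 2 + Q.b * u * v + Q.c * v ^ 2 with hα
  set β := Q.a * u' ^ 2 + Q.b * u' * v' + Q.c * v' ^ 2 with hβ
  set η := 2 * Q.a * u * u' + Q.b * (u * v' + u' * v) + 2 * Q.c * v * v' with hη
  have hrel : η ^ 2 - 4 * (α * β) = Q.disc * (u * v' - u' * v) ^ 2 := by
    rw [hα, hβ, hη, IntForm.disc]
    ring
  have hle : η ^ 2 - 4 * (α * β) ≤ M := by
    rw [hrel, hM]
    exact mul_le_mul_of_nonneg_right ((le_abs_self _).trans hQ) (sq_nonneg _)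
  have hα0 : α ≠ 0 := by
    rintro h
    simp [h] at hneg
  have hβ0 : β ≠ 0 := by
    rintro h
    simp [h] at hneg
  have hαβ : |α| * |β| = -(α * β) := by rw [← abs_mul, abs_of_neg hneg]
  have hα1 := Int.one_le_abs hα0
  have hβ1 := Int.one_le_abs hβ0
  have h1 : |α| ≤ M := by nlinarith [sq_nonneg η]
  have h2 : |β| ≤ M := by nlinarith [sq_nonneg η]
  have h3 : |η| ≤ M := by
    have : |η| ≤ η ^ 2 := by
      rw [← sq_abs]
      exact Int.le_self_sq _
    linarith
  exact ⟨abs_le.mp h1, abs_le.mp h2, abs_le.mp h3⟩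

/-- Integral homogeneous coordinates of a point of `ℙ¹(ℚ)`. -/
theorem exists_int_homog (r : OnePoint ℚ) : ∃ (u v : ℤ) (l : ℚ), l ≠ 0 ∧
    (u : ℚ) = l * (rhomog r).1 ∧ (v : ℚ) = l * (rhomog r).2 := by
  cases r with
  | infty => exact ⟨1, 0, 1, by simp [rhomog]⟩
  | coe t => exact ⟨t.num, t.den, t.den, by simp [rhomog, Rat.den_mul_eq_num]⟩

theorem rhomog_det_ne_zero {r s : OnePoint ℚ} (h : r ≠ s) :
    (rhomog r).1 * (rhomog s).2 - (rhomog s).1 * (rhomog r).2 ≠ 0 := by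
  cases r <;> cases s <;> simp_all [rhomog, sub_eq_zero]

theorem finite_sigmaSet_disc_le (hK : Module.finrank ℚ K = 2) (σ : K →+* ℝ) {p : ℕ}
    {τ : K} (hτ : τ ∉ Set.range ((↑) : ℚ → K)) (r s : OnePoint ℚ) (N : ℤ) :
    {ω ∈ SigmaSet p σ τ r s | |(formOf σ ω).disc| ≤ N}.Finite := by
  have hneg : ∀ ω ∈ SigmaSet p σ τ r s, rootForm (σ ω) (σ (galConj ω)) (ratPoint r) *
      rootForm (σ ω) (σ (galConj ω)) (ratPoint s) < 0 := fun ω hω => by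
    have hω' := orbit_notMem_range hτ hω.1
    exact (geodesic_inter_nonempty_iff (rootForm_ne_zero hK σ hω' r)
      (rootForm_ne_zero hK σ hω' s)).mp hω.2
  -- For `r = s` the product of values is a square, so no geodesic is counted.
  by_cases hrs : r = s
  · subst hrs
    convert Set.finite_empty
    ext ω
    simp only [Set.mem_ofPred_eq, Set.mem_empty_iff_false, iff_false]
    rintro ⟨hω, -⟩
    exact absurd (hneg ω hω) (not_lt.mpr (mul_self_nonneg _))
  obtain ⟨u, v, l, hl, hu, hv⟩ := exists_int_homog r
  obtain ⟨u', v', l', hl', hu', hv'⟩ := exists_int_homog s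
  have hd : u * v' - u' * v ≠ 0 := by
    have h : ((u * v' - u' * v : ℤ) : ℚ) =
        l * l' * ((rhomog r).1 * (rhomog s).2 - (rhomog s).1 * (rhomog r).2) := by
      push_cast
      rw [hu, hv, hu', hv']
      ring
    have h' : ((u * v' - u' * v : ℤ) : ℚ) ≠ 0 := by
      rw [h]
      exact mul_ne_zero (mul_ne_zero hl hl') (rhomog_det_ne_zero hrs)
    exact_mod_cast h'
  refine Set.Finite.of_finite_image (f := formOf σ) ((finite_setOf_intForm hd N).subset ?_) ?_
  · rintro _ ⟨ω, ⟨hω, hN⟩, rfl⟩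
    refine ⟨hN, ?_⟩
    have hω' := orbit_notMem_range hτ hω.1
    obtain ⟨hb, hc⟩ := formOf_vieta hK σ hω'
    have hb' := congrArg σ hb
    have hc' := congrArg σ hc
    simp only [map_intCast, map_mul, map_neg, map_add] at hb' hc'
    -- The forms have integral values at integral coordinates. Passing to `rootForm` costs `a` twice
    -- and squares of `l`, `l'`, which do not change the sign of the product.
    have key : ∀ (t : OnePoint ℚ) (x y : ℤ) (m : ℚ), (x : ℚ) = m * (rhomog t).1 →
        (y : ℚ) = m * (rhomog t).2 →
        (((formOf σ ω).a * x ^ 2 + (formOf σ ω).b * x * y + (formOf σ ω).c * y ^ 2 : ℤ) : ℝ) =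
        (formOf σ ω).a * m ^ 2 * rootForm (σ ω) (σ (galConj ω)) (ratPoint t) := by
      intro t x y m hx hy
      have hx' : (x : ℝ) = m * (rhomog t).1 := by exact_mod_cast congrArg ((↑) : ℚ → ℝ) hx
      have hy' : (y : ℝ) = m * (rhomog t).2 := by exact_mod_cast congrArg ((↑) : ℚ → ℝ) hy
      push_cast
      rw [hb', hc', hx', hy', rootForm, homog_ratPoint]
      ring
    have ha : ((formOf σ ω).a : ℝ) ≠ 0 := by exact_mod_cast formOf_a_ne_zero hK σ hω'
    have hl1 : (l : ℝ) ≠ 0 := by exact_mod_cast hl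
    have hl1' : (l' : ℝ) ≠ 0 := by exact_mod_cast hl'
    rw [← Int.cast_lt_zero (R := ℝ), Int.cast_mul, key r u v l hu hv, key s u' v' l' hu' hv']
    have : 0 < (((formOf σ ω).a : ℝ) * l * l') ^ 2 := by positivity
    have h2 := mul_neg_of_pos_of_neg this (hneg ω hω)
    refine lt_of_eq_of_lt ?_ h2
    ring
  · rintro ω ⟨hω, -⟩ ω' ⟨hω', -⟩ h
    exact eq_of_formOf_eq hK σ (orbit_notMem_range hτ hω.1) (orbit_notMem_range hτ hω'.1) h

end Forms

/-! ### The affinoids of the `p`-adic upper half plane -/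

section Ultrametric

variable {E : Type*} [SeminormedAddCommGroup E] [IsUltrametricDist E]

theorem ultrametric_norm_sub_le_max (x y : E) : ‖x - y‖ ≤ max ‖x‖ ‖y‖ := by
  rw [sub_eq_add_neg, ← norm_neg y]
  exact IsUltrametricDist.norm_add_le_max x (-y)

theorem ultrametric_norm_sub_eq_max {x y : E} (h : ‖x‖ ≠ ‖y‖) : ‖x - y‖ = max ‖x‖ ‖y‖ := by
  rw [← norm_neg y] at h ⊢
  rw [sub_eq_add_neg, IsUltrametricDist.norm_add_eq_max_of_norm_ne_norm h]

end Ultrametric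

section Padic

variable {p : ℕ} [Fact p.Prime]

theorem norm_intCast_padicComplex (n : ℤ) : ‖(n : ℂ_[p])‖ = ‖(n : ℚ_[p])‖ := by
  rw [← map_intCast (algebraMap ℚ_[p] ℂ_[p]), norm_algebraMap']

theorem norm_intCast_le_one (n : ℤ) : ‖(n : ℂ_[p])‖ ≤ 1 := by
  rw [norm_intCast_padicComplex]
  exact Padic.norm_int_le_one n

theorem norm_intCast_lt_one_iff (n : ℤ) : ‖(n : ℂ_[p])‖ < 1 ↔ (p : ℤ) ∣ n := by
  rw [norm_intCast_padicComplex]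
  exact Padic.norm_intCast_lt_one_iff

theorem norm_p : ‖(p : ℂ_[p])‖ = (p : ℝ)⁻¹ := by
  rw [← map_natCast (algebraMap ℚ_[p] ℂ_[p]), norm_algebraMap', Padic.norm_p]

theorem prime_pos_real : (0 : ℝ) < p := by exact_mod_cast (Fact.out : p.Prime).pos

theorem one_lt_prime_real : (1 : ℝ) < p := by exact_mod_cast (Fact.out : p.Prime).one_lt

theorem inv_pow_prime_pos (n : ℕ) : 0 < ((p : ℝ) ^ n)⁻¹ := inv_pos.mpr (pow_pos prime_pos_real n)

/-- The prime-to-`p` part of an integer, as the product of its archimedean and `p`-adic norms. -/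
theorem abs_mul_norm_eq {D D' : ℤ} {m n : ℕ} (h : (p : ℤ) ^ m * D = (p : ℤ) ^ n * D') :
    |(D : ℝ)| * ‖(D : ℂ_[p])‖ = |(D' : ℝ)| * ‖(D' : ℂ_[p])‖ := by
  have key : ∀ (D : ℤ) (m : ℕ), |(D : ℝ)| * ‖(D : ℂ_[p])‖ =
      |(((p : ℤ) ^ m * D : ℤ) : ℝ)| * ‖(((p : ℤ) ^ m * D : ℤ) : ℂ_[p])‖ := by
    intro D m
    have hp := (prime_pos_real (p := p)).ne'
    push_cast
    rw [abs_mul, norm_mul, norm_pow, norm_p, abs_pow, Nat.abs_cast, inv_pow]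
    field_simp
  rw [key D m, key D' n, h]

/-- The defining inequality is made homogeneous: divide `(x, y)` by its coordinate of larger norm to
reach a primitive vector. -/
theorem HpLe_le_norm_sub {n : ℕ} {z : ℂ_[p]} (hz : z ∈ HpLe p n) (x y : ℚ_[p]) :
    ((p : ℝ) ^ n)⁻¹ * max 1 ‖z‖ * max ‖x‖ ‖y‖ ≤
      ‖algebraMap ℚ_[p] ℂ_[p] y * z - algebraMap ℚ_[p] ℂ_[p] x‖ := by
  have hz' : ∀ u v : ℚ_[p], max ‖u‖ ‖v‖ = 1 → ((p : ℝ) ^ n)⁻¹ * max 1 ‖z‖ ≤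
      ‖algebraMap ℚ_[p] ℂ_[p] v * z - algebraMap ℚ_[p] ℂ_[p] u‖ := fun u v h =>
    hz ⟨u, (le_max_left _ _).trans h.le⟩ ⟨v, (le_max_right _ _).trans h.le⟩ h
  have scale : ∀ c : ℚ_[p], max ‖x‖ ‖y‖ = ‖c‖ → c ≠ 0 → ((p : ℝ) ^ n)⁻¹ * max 1 ‖z‖ * max ‖x‖ ‖y‖ ≤
      ‖algebraMap ℚ_[p] ℂ_[p] y * z - algebraMap ℚ_[p] ℂ_[p] x‖ := by
    intro c hc hc0
    have hcn : 0 < ‖c‖ := norm_pos_iff.mpr hc0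
    have hcC : algebraMap ℚ_[p] ℂ_[p] c ≠ 0 := by
      rwa [Ne, map_eq_zero]
    have h := hz' (x / c) (y / c) (by
      rw [norm_div, norm_div, max_div_div_right hcn.le, hc, div_self hcn.ne'])
    have h2 : algebraMap ℚ_[p] ℂ_[p] y * z - algebraMap ℚ_[p] ℂ_[p] x =
        (algebraMap ℚ_[p] ℂ_[p] (y / c) * z - algebraMap ℚ_[p] ℂ_[p] (x / c)) *
          algebraMap ℚ_[p] ℂ_[p] c := by
      rw [map_div₀, map_div₀]
      field_simp
    rw [h2, norm_mul, norm_algebraMap', hc]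
    exact mul_le_mul_of_nonneg_right h (norm_nonneg _)
  by_cases h0 : x = 0 ∧ y = 0
  · simp [h0.1, h0.2]
  rcases le_total ‖x‖ ‖y‖ with h | h
  · refine scale y (max_eq_right h) ?_
    rintro rfl
    exact h0 ⟨by simpa using h, rfl⟩
  · refine scale x (max_eq_left h) ?_
    rintro rfl
    exact h0 ⟨rfl, by simpa using h⟩

theorem HpLe_subset_Hp (n : ℕ) : HpLe p n ⊆ Hp p := by
  rintro z hz ⟨x, rfl⟩
  have h := HpLe_le_norm_sub hz x 1
  rw [map_one, one_mul, sub_self, norm_zero, norm_one] at h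
  have : 0 < ((p : ℝ) ^ n)⁻¹ * max 1 ‖algebraMap ℚ_[p] ℂ_[p] x‖ * max ‖x‖ 1 :=
    mul_pos (mul_pos (inv_pow_prime_pos n) (lt_max_of_lt_left one_pos)) (lt_max_of_lt_right one_pos)
  linarith

theorem norm_le_of_mem_HpLe {n : ℕ} {z : ℂ_[p]} (hz : z ∈ HpLe p n) : ‖z‖ ≤ (p : ℝ) ^ n := by
  have h := HpLe_le_norm_sub hz 1 0
  rw [map_zero, zero_mul, map_one, zero_sub, norm_neg, norm_one, norm_one, norm_zero,
    max_eq_left zero_le_one, mul_one, inv_mul_le_iff₀ (pow_pos prime_pos_real n), mul_one] at h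
  exact (le_max_right _ _).trans h

theorem rat_notMem_Hp {z : ℂ_[p]} (hz : z ∈ Hp p) : z ∉ Set.range ((↑) : ℚ → ℂ_[p]) := by
  rintro ⟨q, rfl⟩
  exact hz ⟨q, map_ratCast _ q⟩

theorem subset_HpLe_of_forall_le {X : Set ℂ_[p]} {R e : ℝ} (he : 0 < e)
    (hR : ∀ z ∈ X, ‖z‖ ≤ R) (hX : ∀ z ∈ X, ∀ x : ℚ_[p], e ≤ ‖z - algebraMap ℚ_[p] ℂ_[p] x‖) :
    ∃ n, X ⊆ HpLe p n := by
  set M := max 1 R with hM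
  have hM1 : 1 ≤ M := le_max_left _ _
  have hM0 : 0 < M := by linarith
  -- The first bound serves vectors with `v` small, where `u` is a unit dominating `v * z`; the
  -- second serves the others, where `u / v` is at distance at least `e` from `z`.
  have hmin : 0 < min M⁻¹ (e * (M⁻¹ / M)) := by positivity
  obtain ⟨n, hn⟩ := exists_pow_lt_of_lt_one hmin (inv_lt_one_of_one_lt₀ (one_lt_prime_real (p := p)))
  rw [inv_pow] at hn
  refine ⟨n, fun z hz u v huv => ?_⟩
  have hzM : max 1 ‖z‖ ≤ M := max_le_max le_rfl (hR z hz)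
  have h1 : ((p : ℝ) ^ n)⁻¹ * max 1 ‖z‖ ≤ ((p : ℝ) ^ n)⁻¹ * M :=
    mul_le_mul_of_nonneg_left hzM (inv_pow_prime_pos n).le
  refine h1.trans ?_
  rcases lt_or_ge ‖(v : ℚ_[p])‖ M⁻¹ with hv | hv
  · have hvz : ‖algebraMap ℚ_[p] ℂ_[p] (v : ℚ_[p]) * z‖ < 1 := by
      rw [norm_mul, norm_algebraMap']
      calc ‖(v : ℚ_[p])‖ * ‖z‖ ≤ ‖(v : ℚ_[p])‖ * M :=
            mul_le_mul_of_nonneg_left ((le_max_right _ _).trans hzM) (norm_nonneg _)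
        _ < M⁻¹ * M := mul_lt_mul_of_pos_right hv hM0
        _ = 1 := inv_mul_cancel₀ hM0.ne'
    have hu : ‖algebraMap ℚ_[p] ℂ_[p] (u : ℚ_[p])‖ = 1 := by
      rw [norm_algebraMap']
      rcases max_choice ‖u‖ ‖v‖ with h | h
      · rw [h] at huv
        exact huv
      · rw [h] at huv
        have : ‖(v : ℚ_[p])‖ = 1 := huv
        rw [this] at hv
        exact absurd (inv_le_one_of_one_le₀ hM1) (not_le.mpr hv)
    have h2 : ‖algebraMap ℚ_[p] ℂ_[p] (v : ℚ_[p]) * z - algebraMap ℚ_[p] ℂ_[p] (u : ℚ_[p])‖ = 1 := by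
      rw [ultrametric_norm_sub_eq_max (by rw [hu]; exact hvz.ne), hu,
        max_eq_right hvz.le]
    rw [h2]
    have := (hn.trans_le (min_le_left _ _)).le
    calc ((p : ℝ) ^ n)⁻¹ * M ≤ M⁻¹ * M := mul_le_mul_of_nonneg_right this hM0.le
      _ = 1 := inv_mul_cancel₀ hM0.ne'
  · have hv0 : (v : ℚ_[p]) ≠ 0 := by
      rw [← norm_pos_iff]
      exact (inv_pos.mpr hM0).trans_le hv
    have hvC : algebraMap ℚ_[p] ℂ_[p] (v : ℚ_[p]) ≠ 0 := by rwa [Ne, map_eq_zero]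
    have h2 : algebraMap ℚ_[p] ℂ_[p] (v : ℚ_[p]) * z - algebraMap ℚ_[p] ℂ_[p] (u : ℚ_[p]) =
        algebraMap ℚ_[p] ℂ_[p] (v : ℚ_[p]) * (z - algebraMap ℚ_[p] ℂ_[p] (u / v : ℚ_[p])) := by
      rw [map_div₀]
      field_simp
    rw [h2, norm_mul, norm_algebraMap']
    have := (hn.trans_le (min_le_right _ _)).le
    calc ((p : ℝ) ^ n)⁻¹ * M ≤ e * (M⁻¹ / M) * M := mul_le_mul_of_nonneg_right this hM0.le
      _ = M⁻¹ * e := by field_simp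
      _ ≤ _ := mul_le_mul hv (hX z hz _) he.le (norm_nonneg _)

theorem IsConnectedAffinoid.isClosed {X : Set ℂ_[p]} (hX : IsConnectedAffinoid p X) :
    IsClosed X := by
  obtain ⟨a, b, I, -, -, rfl⟩ := hX
  have : {z : ℂ_[p] | ‖z - a‖ ≤ ‖b‖ ∧ ∀ i ∈ I, ‖i.2‖ ≤ ‖z - i.1‖} =
      {z | ‖z - a‖ ≤ ‖b‖} ∩ ⋂ i ∈ I, {z | ‖i.2‖ ≤ ‖z - i.1‖} := by
    ext z
    simp
  rw [this]
  refine (isClosed_le (by fun_prop) (by fun_prop)).inter (isClosed_biInter fun i _ => ?_)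
  exact isClosed_le (by fun_prop) (by fun_prop)

theorem IsConnectedAffinoid.isBounded {X : Set ℂ_[p]} (hX : IsConnectedAffinoid p X) :
    Bornology.IsBounded X := by
  obtain ⟨a, b, I, -, -, rfl⟩ := hX
  refine Metric.isBounded_closedBall.subset (t := Metric.closedBall a ‖b‖) fun z hz => ?_
  rw [mem_closedBall_iff_norm]
  exact hz.1

theorem IsAffinoid.isClosed {X : Set ℂ_[p]} (hX : IsAffinoid p X) : IsClosed X := by
  obtain ⟨C, hC, h, rfl⟩ := hX
  rw [Set.sUnion_eq_biUnion]
  exact hC.isClosed_biUnion fun Y hY => (h Y hY).isClosed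

theorem IsAffinoid.isBounded {X : Set ℂ_[p]} (hX : IsAffinoid p X) : Bornology.IsBounded X := by
  obtain ⟨C, hC, h, rfl⟩ := hX
  exact (Bornology.isBounded_sUnion hC).mpr fun Y hY => (h Y hY).isBounded

/-- An affinoid is closed and bounded, and the ball of radius `R` in `ℚ_p` is compact, so the two
are a positive distance apart. Points of `ℚ_p` of norm above `R` are at distance more than `R` from
`X`. -/
theorem IsAffinoid.subset_HpLe {X : Set ℂ_[p]} (hX : IsAffinoid p X) (hXH : X ⊆ Hp p) :
    ∃ n, X ⊆ HpLe p n := by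
  obtain ⟨R, hR0, hR⟩ := hX.isBounded.exists_pos_norm_le
  have hcpt : IsCompact (algebraMap ℚ_[p] ℂ_[p] '' Metric.closedBall 0 R) :=
    (isCompact_closedBall 0 R).image (algebraMapCLM ℚ_[p] ℂ_[p]).continuous
  have hdisj : Disjoint (algebraMap ℚ_[p] ℂ_[p] '' Metric.closedBall 0 R) X := by
    rw [Set.disjoint_left]
    rintro _ ⟨x, -, rfl⟩ hx
    exact hXH hx ⟨x, rfl⟩
  obtain ⟨e, he, hthick⟩ := hdisj.exists_thickenings hcpt hX.isClosed
  refine subset_HpLe_of_forall_le (e := min e R) (R := R) (lt_min he hR0) hR fun z hz x => ?_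
  rcases le_or_gt ‖x‖ R with hx | hx
  · refine (min_le_left _ _).trans ?_
    by_contra! hlt
    refine Set.disjoint_left.mp hthick ?_ (Metric.self_subset_thickening he X hz)
    rw [Metric.mem_thickening_iff]
    exact ⟨_, ⟨x, by simpa using hx, rfl⟩, by rwa [dist_eq_norm]⟩
  · have hne : ‖z‖ ≠ ‖algebraMap ℚ_[p] ℂ_[p] x‖ := by
      rw [norm_algebraMap']
      exact ((hR z hz).trans_lt hx).ne
    rw [ultrametric_norm_sub_eq_max hne, norm_algebraMap']
    exact (min_le_right _ _).trans (hx.le.trans (le_max_right _ _))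

/-! ### Infinitely many points in each `HpLe p n` -/

theorem norm_pow_prime_sub_lt_one (u : ℤ_[p]) : ‖u ^ p - u‖ < 1 := by
  have hp : p.Prime := Fact.out
  have h : PadicInt.toZMod (u ^ p - u) = 0 := by
    rw [map_sub, map_pow, ZMod.pow_card, sub_self]
  rwa [← RingHom.mem_ker, PadicInt.ker_toZMod, PadicInt.maximalIdeal_eq_span_p,
    Ideal.mem_span_singleton, ← PadicInt.norm_lt_one_iff_dvd] at h

/-- The reduction of such a `z` is outside the field with `p` elements, so `z` is at distance at
least `1` from `ℤ_p`: the map `w ↦ w ^ p - w` is contracting enough on the unit ball and sends `ℤ_p`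
into `p ℤ_p`. -/
theorem mem_HpLe_of_norm_pow_sub {n : ℕ} {z : ℂ_[p]} (hz : ‖z‖ ≤ 1) (hz' : ‖z ^ p - z‖ = 1) :
    z ∈ HpLe p n := by
  have hp : p.Prime := Fact.out
  have hle : ((p : ℝ) ^ n)⁻¹ ≤ 1 := inv_le_one_of_one_le₀ (one_le_pow₀ one_lt_prime_real.le)
  have hint : ∀ x : ℚ_[p], ‖x‖ ≤ 1 → 1 ≤ ‖z - algebraMap ℚ_[p] ℂ_[p] x‖ := by
    intro x hx
    by_contra! hlt
    set w := algebraMap ℚ_[p] ℂ_[p] x with hw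
    have hwn : ‖w‖ ≤ 1 := by rwa [hw, norm_algebraMap']
    have h1 : ‖w ^ p - w‖ < 1 := by
      have := norm_pow_prime_sub_lt_one (p := p) ⟨x, hx⟩
      rw [hw, ← map_pow, ← map_sub, norm_algebraMap']
      exact this
    have h2 : ‖z ^ p - w ^ p‖ < 1 := by
      rw [← (Commute.all z w).geom_sum₂_mul, norm_mul]
      refine (mul_le_of_le_one_left (norm_nonneg _) ?_).trans_lt hlt
      refine IsUltrametricDist.norm_sum_le_of_forall_le_of_nonneg zero_le_one fun i _ => ?_
      rw [norm_mul, norm_pow, norm_pow]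
      exact mul_le_one₀ (pow_le_one₀ (norm_nonneg _) hz) (by positivity)
        (pow_le_one₀ (norm_nonneg _) hwn)
    have h3 : z ^ p - z = (z ^ p - w ^ p) + ((w ^ p - w) - (z - w)) := by ring
    rw [h3] at hz'
    have h4 := IsUltrametricDist.norm_add_le_max (z ^ p - w ^ p) ((w ^ p - w) - (z - w))
    have h5 : ‖(w ^ p - w) - (z - w)‖ ≤ max ‖w ^ p - w‖ ‖z - w‖ :=
      ultrametric_norm_sub_le_max _ _
    rw [hz'] at h4
    exact absurd (h4.trans (max_le_max le_rfl h5)) (not_le.mpr (max_lt h2 (max_lt h1 hlt)))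
  intro u v huv
  rw [max_eq_left hz, mul_one]
  refine hle.trans ?_
  rcases lt_or_eq_of_le (PadicInt.norm_le_one v) with hv | hv
  · have hv' : ‖(v : ℚ_[p])‖ < 1 := hv
    have hvz : ‖algebraMap ℚ_[p] ℂ_[p] (v : ℚ_[p]) * z‖ < 1 := by
      rw [norm_mul, norm_algebraMap']
      exact (mul_le_of_le_one_right (norm_nonneg _) hz).trans_lt hv'
    have hu : ‖algebraMap ℚ_[p] ℂ_[p] (u : ℚ_[p])‖ = 1 := by
      rw [norm_algebraMap']
      rcases max_choice ‖u‖ ‖v‖ with h | h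
      · rw [h] at huv
        exact huv
      · rw [h] at huv
        exact absurd huv hv.ne
    rw [ultrametric_norm_sub_eq_max (by rw [hu]; exact hvz.ne), hu]
    exact le_max_right _ _
  · have hv' : ‖(v : ℚ_[p])‖ = 1 := hv
    have hv0 : (v : ℚ_[p]) ≠ 0 := by
      rw [← norm_pos_iff, hv']
      exact one_pos
    have hvC : algebraMap ℚ_[p] ℂ_[p] (v : ℚ_[p]) ≠ 0 := by rwa [Ne, map_eq_zero]
    have h2 : algebraMap ℚ_[p] ℂ_[p] (v : ℚ_[p]) * z - algebraMap ℚ_[p] ℂ_[p] (u : ℚ_[p]) =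
        algebraMap ℚ_[p] ℂ_[p] (v : ℚ_[p]) * (z - algebraMap ℚ_[p] ℂ_[p] (u / v : ℚ_[p])) := by
      rw [map_div₀]
      field_simp
    rw [h2, norm_mul, norm_algebraMap', hv', one_mul]
    apply hint
    rw [norm_div, hv', div_one]
    exact PadicInt.norm_le_one u

/-- Roots of `z ^ p - z = 1 + p * j` for distinct `j` are distinct. This keeps a nonzero polynomial
from vanishing on all of `HpLe p n`. -/
theorem infinite_HpLe (n : ℕ) : (HpLe p n).Infinite := by
  have hp : p.Prime := Fact.out
  have hex : ∀ j : ℕ, ∃ z : ℂ_[p], z ^ p - z = 1 + p * j := by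
    intro j
    obtain ⟨z, hz⟩ := IsAlgClosed.exists_root
      (Polynomial.X ^ p - (Polynomial.X + Polynomial.C (1 + p * j : ℂ_[p]))) (by
        have : (Polynomial.X ^ p - (Polynomial.X + Polynomial.C (1 + p * j : ℂ_[p]))).natDegree
            = p := by
          rw [Polynomial.natDegree_sub_eq_left_of_natDegree_lt, Polynomial.natDegree_X_pow]
          rw [Polynomial.natDegree_X_add_C, Polynomial.natDegree_X_pow]
          exact hp.one_lt
        intro h
        have h' := Polynomial.natDegree_eq_of_degree_eq_some h
        rw [this] at h'
        exact hp.ne_zero h')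
    refine ⟨z, ?_⟩
    simp only [Polynomial.IsRoot, Polynomial.eval_sub, Polynomial.eval_add, Polynomial.eval_pow,
      Polynomial.eval_X, Polynomial.eval_C] at hz
    linear_combination hz
  choose f hf using hex
  have hinj : Function.Injective f := by
    intro i j h
    have h1 := hf i
    rw [h, hf j] at h1
    have hp0 : (p : ℂ_[p]) ≠ 0 := by exact_mod_cast hp.ne_zero
    have h2 : (p : ℂ_[p]) * j = p * i := add_left_cancel h1
    exact_mod_cast (mul_left_cancel₀ hp0 h2).symm
  refine Set.infinite_of_injective_forall_mem hinj fun j => ?_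
  have h1 : ‖(1 + p * j : ℂ_[p])‖ = 1 := by
    have hlt : ‖(p * j : ℂ_[p])‖ < 1 := by
      have := (norm_intCast_lt_one_iff (p := p) (p * j)).mpr ⟨j, rfl⟩
      push_cast at this
      exact this
    rw [IsUltrametricDist.norm_add_eq_max_of_norm_ne_norm (by rw [norm_one]; exact hlt.ne'),
      norm_one, max_eq_left hlt.le]
  have h2 : ‖f j ^ p - f j‖ = 1 := by rw [hf, h1]
  refine mem_HpLe_of_norm_pow_sub ?_ h2
  by_contra! hgt
  have h3 : ‖f j‖ < ‖f j ^ p‖ := by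
    rw [norm_pow]
    exact lt_self_pow₀ hgt hp.one_lt
  rw [ultrametric_norm_sub_eq_max h3.ne', max_eq_left h3.le] at h2
  exact absurd h2 (hgt.trans h3).ne'

end Padic

/-! ### Estimates for the terms of the series -/

section Estimates

variable {p : ℕ} [Fact p.Prime]

/-- If `p` divided `a`, `c` and the discriminant, it would divide `b ^ 2`, against primitivity; this
also covers `p = 2`. -/
theorem IntForm.Primitive.norm_a_or_c {Q : IntForm} (hQ : Q.Primitive)
    (hD : ‖(Q.disc : ℂ_[p])‖ < 1) : ‖(Q.a : ℂ_[p])‖ = 1 ∨ ‖(Q.c : ℂ_[p])‖ = 1 := by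
  have hp : p.Prime := Fact.out
  by_contra! h
  have ha := (norm_intCast_lt_one_iff Q.a).mp (lt_of_le_of_ne (norm_intCast_le_one Q.a) h.1)
  have hc := (norm_intCast_lt_one_iff Q.c).mp (lt_of_le_of_ne (norm_intCast_le_one Q.c) h.2)
  have hd := (norm_intCast_lt_one_iff Q.disc).mp hD
  have hb2 : (p : ℤ) ∣ Q.b ^ 2 := by
    have : Q.b ^ 2 = Q.disc + 4 * Q.a * Q.c := by rw [IntForm.disc]; ring
    rw [this]
    exact dvd_add hd (hc.mul_left _)
  have hb := (Nat.prime_iff_prime_int.mp hp).dvd_of_dvd_pow hb2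
  have h1 : (p : ℤ) ∣ (Int.gcd (Int.gcd Q.a Q.b) Q.c : ℤ) :=
    Int.dvd_coe_gcd (Int.dvd_coe_gcd ha hb) hc
  rw [show Int.gcd (Int.gcd Q.a Q.b) Q.c = 1 from hQ] at h1
  have h2 : p ∣ 1 := by exact_mod_cast h1
  exact hp.one_lt.ne' (Nat.dvd_one.mp h2)

theorem le_norm_linear {n : ℕ} {z : ℂ_[p]} (hz : z ∈ HpLe p n) (a b : ℤ) :
    ((p : ℝ) ^ n)⁻¹ * max 1 ‖z‖ * max ‖(b : ℂ_[p])‖ ‖(a : ℂ_[p])‖ ≤ ‖(a : ℂ_[p]) * z + b‖ := by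
  have h := HpLe_le_norm_sub hz (-b) a
  rw [norm_neg, map_neg, map_intCast, map_intCast, sub_neg_eq_add] at h
  rwa [norm_intCast_padicComplex, norm_intCast_padicComplex]

/-- A primitive form whose discriminant is `p`-adically small is bounded below on `HpLe p n`. -/
theorem IntForm.Primitive.le_norm_eval {Q : IntForm} (hQ : Q.Primitive) {n : ℕ} {z : ℂ_[p]}
    (hz : z ∈ HpLe p n) (hD : ‖(Q.disc : ℂ_[p])‖ < (((p : ℝ) ^ n)⁻¹ * ‖(2 : ℂ_[p])‖) ^ 2) :
    (((p : ℝ) ^ n)⁻¹) ^ 2 ≤ ‖Q.eval z‖ := by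
  set q := ((p : ℝ) ^ n)⁻¹ with hq
  have hq0 : 0 < q := inv_pow_prime_pos n
  have hq1 : q ≤ 1 := inv_le_one_of_one_le₀ (one_le_pow₀ one_lt_prime_real.le)
  set M := max 1 ‖z‖ with hM
  have hM1 : 1 ≤ M := le_max_left _ _
  have h2 : ‖(2 : ℂ_[p])‖ ≤ 1 := by
    have := norm_intCast_le_one (p := p) 2
    exact_mod_cast this
  have h20 : 0 < ‖(2 : ℂ_[p])‖ := norm_pos_iff.mpr two_ne_zero
  have hqm : q ≤ q * M := le_mul_of_one_le_right hq0.le hM1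
  have hD1 : ‖(Q.disc : ℂ_[p])‖ < 1 := hD.trans_le
    (pow_le_one₀ (by positivity) (mul_le_one₀ hq1 h20.le h2))
  -- Completing the square gives `4aQ(z) = (2az + b)² - D` and `4cQ(z) = (bz + 2c)² - Dz²`. One of
  -- `a`, `c` is a unit, and the square dominates strictly. The norm of `2` matters only for `p =
  -- 2`.
  have key : ∀ (e w y : ℂ_[p]), ‖e‖ = 1 → ‖y‖ ≤ M → q * M * ‖(2 : ℂ_[p])‖ ≤ ‖w‖ →
      4 * e * Q.eval z = w ^ 2 - Q.disc * y ^ 2 → q ^ 2 ≤ ‖Q.eval z‖ := by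
    intro e w y he hy hw heq
    have h1 : (q * M * ‖(2 : ℂ_[p])‖) ^ 2 ≤ ‖w ^ 2‖ := by
      rw [norm_pow]
      exact pow_le_pow_left₀ (by positivity) hw 2
    have h3 : ‖(Q.disc : ℂ_[p]) * y ^ 2‖ < ‖w ^ 2‖ := by
      refine lt_of_lt_of_le ?_ h1
      rw [norm_mul, norm_pow]
      calc ‖(Q.disc : ℂ_[p])‖ * ‖y‖ ^ 2 ≤ ‖(Q.disc : ℂ_[p])‖ * M ^ 2 := by gcongr
        _ < (q * ‖(2 : ℂ_[p])‖) ^ 2 * M ^ 2 := by gcongr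
        _ = _ := by ring
    have h4 : ‖4 * e * Q.eval z‖ = ‖w ^ 2‖ := by
      rw [heq, ultrametric_norm_sub_eq_max h3.ne', max_eq_left h3.le]
    have h5 : ‖(4 : ℂ_[p])‖ = ‖(2 : ℂ_[p])‖ ^ 2 := by
      rw [← norm_pow]
      norm_num
    rw [norm_mul, norm_mul, he, mul_one, h5] at h4
    have h6 : ‖(2 : ℂ_[p])‖ ^ 2 * (q * M) ^ 2 ≤ ‖(2 : ℂ_[p])‖ ^ 2 * ‖Q.eval z‖ := by
      rw [h4]
      refine le_of_eq_of_le ?_ h1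
      ring
    exact (pow_le_pow_left₀ hq0.le hqm 2).trans (le_of_mul_le_mul_left h6 (by positivity))
  rcases hQ.norm_a_or_c hD1 with ha | hc
  · refine key Q.a (2 * Q.a * z + Q.b) 1 ha (by simpa using hM1) ?_ ?_
    · have := le_norm_linear hz (2 * Q.a) Q.b
      push_cast at this
      refine le_trans ?_ this
      gcongr
      refine le_trans ?_ (le_max_right _ _)
      rw [norm_mul, ha, mul_one]
    · rw [IntForm.eval, IntForm.disc]
      push_cast
      ring
  · refine key Q.c (Q.b * z + 2 * Q.c) z hc (le_max_right _ _) ?_ ?_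
    · have := le_norm_linear hz Q.b (2 * Q.c)
      push_cast at this
      refine le_trans ?_ this
      gcongr
      refine le_trans ?_ (le_max_left _ _)
      rw [norm_mul, hc, mul_one]
    · rw [IntForm.eval, IntForm.disc]
      push_cast
      ring

end Estimates

/-- `K` is a quadratic field. -/
def IsQuadraticField (K : Type*) [Field K] [CharZero K] : Prop := Module.finrank ℚ K = 2

/-- The `ℚ`-module structure of an intermediate field and that of a field of characteristic zero are
equal, since such a structure is unique. -/
theorem isQuadraticField_of_finrank {K : Type*} [Field K] [CharZero K] [inst : Module ℚ K]
    (h : @Module.finrank ℚ K _ _ inst = 2) : IsQuadraticField K := by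
  rw [IsQuadraticField, ← h]
  congr 1
  exact Subsingleton.elim _ _

section Terms

variable {p : ℕ} [Fact p.Prime]

/-- As the real and `p`-adic absolute values of the discriminant have constant product `C` on the
orbit, a lower bound `e` for the second bounds the first by `C / e`. -/
theorem finite_sigmaSet_norm_disc_ge {K : Type*} [Field K] [CharZero K] (hK : IsQuadraticField K)
    (σ : K →+* ℝ) {τ : K} (hτ : τ ∉ Set.range ((↑) : ℚ → K)) (r s : OnePoint ℚ) {e : ℝ}
    (he : 0 < e) :
    {ω ∈ SigmaSet p σ τ r s | e ≤ ‖((formOf σ ω).disc : ℂ_[p])‖}.Finite := by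
  set C := |((formOf σ τ).disc : ℝ)| * ‖((formOf σ τ).disc : ℂ_[p])‖ with hC
  refine (finite_sigmaSet_disc_le (p := p) hK σ hτ r s ⌈C / e⌉).subset ?_
  rintro ω ⟨hω, hle⟩
  refine ⟨hω, ?_⟩
  obtain ⟨m, n, h⟩ := exists_pow_mul_disc hK σ (Fact.out : p.Prime) hτ hω.1
  have h1 := abs_mul_norm_eq h
  have h2 : |((formOf σ ω).disc : ℝ)| ≤ C / e := by
    rw [le_div_iff₀ he, hC, ← h1]
    gcongr
  have h3 := h2.trans (Int.le_ceil _)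
  exact_mod_cast h3

variable {K : IntermediateField ℚ ℂ_[p]}

theorem coe_notMem_range {ω : K} (hω : ω ∉ Set.range ((↑) : ℚ → K)) :
    (ω : ℂ_[p]) ∉ Set.range ((↑) : ℚ → ℂ_[p]) :=
  map_notMem_range (algebraMap K ℂ_[p]) hω

theorem coe_moebius (γ : SL(2, ℚ)) (ω : K) :
    ((moebius γ ω : K) : ℂ_[p]) = moebius γ (ω : ℂ_[p]) :=
  map_moebius (algebraMap K ℂ_[p]) γ ω

theorem formOf_eval_eq (hK : IsQuadraticField K) (σ : K →+* ℝ) {ω : K}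
    (hω : ω ∉ Set.range ((↑) : ℚ → K)) (z : ℂ_[p]) :
    (formOf σ ω).eval z =
      (formOf σ ω).a * ((z - (ω : ℂ_[p])) * (z - ((galConj ω : K) : ℂ_[p]))) :=
  map_formOf_eval hK σ hω (algebraMap K ℂ_[p]) z

theorem coe_posSqrt (hK : IsQuadraticField K) (σ : K →+* ℝ) {ω : K}
    (hω : ω ∉ Set.range ((↑) : ℚ → K)) :
    ((posSqrt σ (formOf σ ω).disc : K) : ℂ_[p]) =
      (formOf σ ω).a * ((ω : ℂ_[p]) - ((galConj ω : K) : ℂ_[p])) := by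
  rw [posSqrt_disc hK σ hω]
  simp

theorem norm_posSqrt_sq (hK : IsQuadraticField K) (σ : K →+* ℝ) {ω : K}
    (hω : ω ∉ Set.range ((↑) : ℚ → K)) :
    ‖((posSqrt σ (formOf σ ω).disc : K) : ℂ_[p])‖ ^ 2 = ‖((formOf σ ω).disc : ℂ_[p])‖ := by
  rw [← norm_pow, coe_posSqrt hK σ hω]
  congr 1
  have := congrArg (algebraMap K ℂ_[p]) (formOf_disc hK σ hω)
  simpa using this.symm

theorem term_eq (hK : IsQuadraticField K) (σ : K →+* ℝ) (k : ℕ) (ε : ℤˣ) {ω : K}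
    (hω : ω ∉ Set.range ((↑) : ℚ → K))
    (r s : OnePoint ℚ) (z : ℂ_[p]) :
    term k ε σ r s ω z = (rmInter ε σ ω r s : ℂ_[p]) *
      (((ω : ℂ_[p]) - ((galConj ω : K) : ℂ_[p])) /
        ((z - (ω : ℂ_[p])) * (z - ((galConj ω : K) : ℂ_[p])))) ^ k := by
  have ha : ((formOf σ ω).a : ℂ_[p]) ≠ 0 := by exact_mod_cast formOf_a_ne_zero hK σ hω
  rw [term, coe_posSqrt hK σ hω, formOf_eval_eq hK σ hω, ← div_pow, mul_div_mul_left _ _ ha]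

/-- Each difference of points is divided by its two automorphy factors. Those of `ω` and `ω'` cancel
in the quotient, leaving `(c z + d) ^ 2`. -/
theorem term_moebius (hK : IsQuadraticField K) (σ : K →+* ℝ) (k : ℕ) (ε : ℤˣ) {ω : K}
    (hω : ω ∉ Set.range ((↑) : ℚ → K))
    (γ : SL(2, ℚ)) (r s : OnePoint ℚ) {z : ℂ_[p]} (hz : z ∉ Set.range ((↑) : ℚ → ℂ_[p])) :
    term k ε σ ((γ : GL (Fin 2) ℚ) • r) ((γ : GL (Fin 2) ℚ) • s) (moebius γ ω) (moebius γ z) =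
      ((γ 1 0 : ℂ_[p]) * z + (γ 1 1 : ℂ_[p])) ^ (2 * k) * term k ε σ r s ω z := by
  have hω1 := coe_notMem_range hω
  have hω2 := coe_notMem_range (galConj_notMem_range hK hω)
  rw [term_eq hK σ k ε hω, term_eq hK σ k ε (moebius_notMem_range γ hω),
    rmInter_moebius hK σ hω, galConj_moebius hK, coe_moebius, coe_moebius,
    moebius_sub_moebius γ hω1 hω2, moebius_sub_moebius γ hz hω1, moebius_sub_moebius γ hz hω2,
    pow_mul, mul_left_comm, ← mul_pow]
  congr 2
  have h1 := denom_ne_zero γ hω1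
  have h2 := denom_ne_zero γ hω2
  have h3 := denom_ne_zero γ hz
  generalize (γ 1 0 : ℂ_[p]) * z + (γ 1 1 : ℂ_[p]) = w at *
  generalize (γ 1 0 : ℂ_[p]) * (ω : ℂ_[p]) + (γ 1 1 : ℂ_[p]) = u at *
  generalize (γ 1 0 : ℂ_[p]) * ((galConj ω : K) : ℂ_[p]) + (γ 1 1 : ℂ_[p]) = v at *
  generalize z - (ω : ℂ_[p]) = x
  generalize z - ((galConj ω : K) : ℂ_[p]) = y
  field_simp

theorem norm_rmInter_le_one (σ : K →+* ℝ) (ε : ℤˣ) (ω : K) (r s : OnePoint ℚ) :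
    ‖(rmInter ε σ ω r s : ℂ_[p])‖ ≤ 1 :=
  norm_intCast_le_one _

theorem norm_term_le (hK : IsQuadraticField K) (σ : K →+* ℝ) {k : ℕ} (hk : 1 ≤ k) (ε : ℤˣ) {ω : K}
    (hω : ω ∉ Set.range ((↑) : ℚ → K))
    (r s : OnePoint ℚ) {n : ℕ} {e : ℝ} (he : 0 < e) (he1 : e ≤ 1)
    (hD : ‖((formOf σ ω).disc : ℂ_[p])‖ <
      min ((((p : ℝ) ^ n)⁻¹ * ‖(2 : ℂ_[p])‖) ^ 2) ((e * (((p : ℝ) ^ n)⁻¹) ^ 2) ^ 2))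
    {z : ℂ_[p]} (hz : z ∈ HpLe p n) :
    (formOf σ ω).eval z ≠ 0 ∧ ‖term k ε σ r s ω z‖ ≤ e := by
  -- The first bound in `hD` keeps the denominator at least `p ^ (-2n)`; the second makes the square
  -- root at most `e` times that. With `e ≤ 1` and `1 ≤ k`, raising to the power `k` does no harm.
  have h1 := (isFormOf_formOf hK σ hω).1.le_norm_eval hz (hD.trans_le (min_le_left _ _))
  have hq : 0 < (((p : ℝ) ^ n)⁻¹) ^ 2 := pow_pos (inv_pow_prime_pos n) 2
  have hpos := hq.trans_le h1
  refine ⟨norm_pos_iff.mp hpos, ?_⟩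
  have h2 : ‖((posSqrt σ (formOf σ ω).disc : K) : ℂ_[p])‖ ≤ e * (((p : ℝ) ^ n)⁻¹) ^ 2 := by
    refine le_of_sq_le_sq ?_ (by positivity)
    rw [norm_posSqrt_sq hK σ hω]
    exact (hD.trans_le (min_le_right _ _)).le
  have h3 : ‖((posSqrt σ (formOf σ ω).disc : K) : ℂ_[p])‖ / ‖(formOf σ ω).eval z‖ ≤ e := by
    rw [div_le_iff₀ hpos]
    exact h2.trans (mul_le_mul_of_nonneg_left h1 he.le)
  rw [term, ← div_pow, norm_mul, norm_pow, norm_div]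
  refine (mul_le_of_le_one_left (by positivity) (norm_rmInter_le_one σ ε ω r s)).trans ?_
  refine (pow_le_of_le_one (by positivity) (h3.trans he1) (by omega)).trans h3

/-- All but finitely many terms are small and have no pole on `HpLe p n`. -/
theorem finite_setOf_not_norm_term_le (hK : IsQuadraticField K) (σ : K →+* ℝ) {k : ℕ} (hk : 1 ≤ k)
    (ε : ℤˣ) {τ : K}
    (hτ : τ ∉ Set.range ((↑) : ℚ → K)) (r s : OnePoint ℚ) (n : ℕ) {e : ℝ} (he : 0 < e) :
    {ω ∈ SigmaSet p σ τ r s | ¬ ∀ z ∈ HpLe p n,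
      (formOf σ ω).eval z ≠ 0 ∧ ‖term k ε σ r s ω z‖ ≤ e}.Finite := by
  have h2 : 0 < ‖(2 : ℂ_[p])‖ := norm_pos_iff.mpr two_ne_zero
  have hq := inv_pow_prime_pos (p := p) n
  have he' : 0 < min e 1 := lt_min he one_pos
  refine (finite_sigmaSet_norm_disc_ge (p := p) hK σ hτ r s (e := min ((((p : ℝ) ^ n)⁻¹ *
    ‖(2 : ℂ_[p])‖) ^ 2) ((min e 1 * (((p : ℝ) ^ n)⁻¹) ^ 2) ^ 2)) (by positivity)).subset ?_
  rintro ω ⟨hω, h⟩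
  refine ⟨hω, ?_⟩
  by_contra! hlt
  refine h fun z hz => ?_
  have := norm_term_le hK σ hk ε (orbit_notMem_range hτ hω.1) r s he' (min_le_right _ _) hlt hz
  exact ⟨this.1, this.2.trans (min_le_left _ _)⟩

end Terms

/-! ### Convergence -/

/-- In a nonarchimedean group, a partial sum containing all terms of norm greater than `e`
is within `e` of the sum of the series. -/
theorem norm_sub_sum_le {ι E : Type*} [NormedAddCommGroup E] [IsUltrametricDist E]
    {g : ι → E} {a : E} (hg : HasSum g a) {e : ℝ} (he : 0 ≤ e) {A : Finset ι}
    (hA : ∀ i ∉ A, ‖g i‖ ≤ e) : ‖a - ∑ i ∈ A, g i‖ ≤ e := by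
  classical
  have h : Filter.Tendsto (fun B : Finset ι => ‖∑ i ∈ B, g i - ∑ i ∈ A, g i‖) Filter.atTop
      (nhds ‖a - ∑ i ∈ A, g i‖) := (Filter.Tendsto.sub_const hg _).norm
  refine le_of_tendsto h (Filter.eventually_atTop.mpr ⟨A, fun B hB => ?_⟩)
  rw [← Finset.sum_sdiff hB, add_sub_cancel_right]
  exact IsUltrametricDist.norm_sum_le_of_forall_le_of_nonneg he fun i hi =>
    hA i (Finset.mem_sdiff.mp hi).2

/-- An ultrametric tail is bounded by its largest term, so terms uniformly small off a finite set
upgrade pointwise sums to uniform ones. -/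
theorem hasSumUniformlyOn_of_finite {ι β E : Type*} [NormedAddCommGroup E] [IsUltrametricDist E]
    {g : ι → β → E} {G : β → E} {X : Set β} (hs : ∀ x ∈ X, HasSum (fun i => g i x) (G x))
    (h : ∀ e : ℝ, 0 < e → {i | ¬ ∀ x ∈ X, ‖g i x‖ ≤ e}.Finite) : HasSumUniformlyOn g G X := by
  rw [hasSumUniformlyOn_iff_tendstoUniformlyOn, Metric.tendstoUniformlyOn_iff]
  intro e he
  have hfin := h (e / 2) (half_pos he)
  refine Filter.eventually_atTop.mpr ⟨hfin.toFinset, fun A hA x hx => ?_⟩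
  rw [dist_eq_norm]
  refine lt_of_le_of_lt (norm_sub_sum_le (hs x hx) (half_pos he).le fun i hi => ?_)
    (half_lt_self he)
  by_contra hc
  exact hi (hA (hfin.mem_toFinset.mpr fun h' => hc (h' x hx)))

section Series

variable {p : ℕ} [Fact p.Prime] {K : IntermediateField ℚ ℂ_[p]}

theorem summable_term (hK : IsQuadraticField K) (σ : K →+* ℝ) {k : ℕ} (hk : 1 ≤ k) (ε : ℤˣ) {τ : K}
    (hτ : τ ∉ Set.range ((↑) : ℚ → K)) (r s : OnePoint ℚ) {n : ℕ} {z : ℂ_[p]}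
    (hz : z ∈ HpLe p n) :
    Summable fun ω : SigmaSet p σ τ r s => term k ε σ r s (ω : K) z := by
  apply NonarchimedeanAddGroup.summable_of_tendsto_cofinite_zero
  rw [Metric.tendsto_nhds]
  intro e he
  rw [Filter.eventually_cofinite]
  refine Set.Finite.of_finite_image (f := Subtype.val)
    ((finite_setOf_not_norm_term_le hK σ hk ε hτ r s n (half_pos he)).subset ?_)
    Subtype.val_injective.injOn
  rintro _ ⟨ω, hω, rfl⟩
  refine ⟨ω.2, fun h => hω ?_⟩
  rw [dist_zero_right]
  exact (h z hz).2.trans_lt (half_lt_self he)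

theorem hasSum_indicator_term (hK : IsQuadraticField K) (σ : K →+* ℝ) {k : ℕ} (hk : 1 ≤ k)
    (ε : ℤˣ) {τ : K} (hτ : τ ∉ Set.range ((↑) : ℚ → K)) (r s : OnePoint ℚ) {n : ℕ} {z : ℂ_[p]}
    (hz : z ∈ HpLe p n) :
    HasSum ((SigmaSet p σ τ r s).indicator fun ω => term k ε σ r s ω z) (Phi k ε σ τ r s z) :=
  hasSum_subtype_iff_indicator.mp (summable_term hK σ hk ε hτ r s hz).hasSum

/-- Poles need no exclusion: a term takes the value `0` there by division by zero, both in the full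
sum and in the finite one. -/
theorem hasSum_diff_finset (hK : IsQuadraticField K) (σ : K →+* ℝ) {k : ℕ} (hk : 1 ≤ k)
    (ε : ℤˣ) {τ : K} (hτ : τ ∉ Set.range ((↑) : ℚ → K)) (r s : OnePoint ℚ) {n : ℕ} {z : ℂ_[p]}
    (hz : z ∈ HpLe p n) {F : Finset K} (hF : (F : Set K) ⊆ SigmaSet p σ τ r s) :
    HasSum (fun ω : (SigmaSet p σ τ r s \ (F : Set K) : Set K) => term k ε σ r s (ω : K) z)
      (Phi k ε σ τ r s z - ∑ ω ∈ F, term k ε σ r s ω z) := by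
  have h1 := hasSum_indicator_term hK σ hk ε hτ r s hz
  have h2 : HasSum ((F : Set K).indicator fun ω => term k ε σ r s ω z)
      (∑ ω ∈ F, term k ε σ r s ω z) :=
    hasSum_subtype_iff_indicator.mp (F.hasSum _)
  have h3 := h1.sub h2
  refine (hasSum_subtype_iff_indicator (f := fun ω => term k ε σ r s ω z)).mpr ?_
  rw [Set.indicator_sdiff hF]
  exact h3

/-- The finite set of terms with a pole on `HpLe p n`. -/
theorem exists_poles (hK : IsQuadraticField K) (σ : K →+* ℝ) {k : ℕ} (hk : 1 ≤ k)
    (ε : ℤˣ) {τ : K} (hτ : τ ∉ Set.range ((↑) : ℚ → K)) (r s : OnePoint ℚ) (n : ℕ) :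
    ∃ F : Finset K, (F : Set K) ⊆ SigmaSet p σ τ r s ∧
      ∀ ω ∈ SigmaSet p σ τ r s, ω ∉ F → ∀ z ∈ HpLe p n, (formOf σ ω).eval z ≠ 0 := by
  -- The bound `1` is arbitrary; the resulting set may also contain terms without poles.
  have hfin := finite_setOf_not_norm_term_le hK σ hk ε hτ r s n one_pos
  refine ⟨hfin.toFinset, fun ω hω => (hfin.mem_toFinset.mp hω).1, fun ω hω hωF z hz => ?_⟩
  by_contra h0
  exact hωF (hfin.mem_toFinset.mpr ⟨hω, fun h => (h z hz).1 h0⟩)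

theorem hasSumUniformlyOn_term (hK : IsQuadraticField K) (σ : K →+* ℝ) {k : ℕ} (hk : 1 ≤ k)
    (ε : ℤˣ) {τ : K} (hτ : τ ∉ Set.range ((↑) : ℚ → K)) (r s : OnePoint ℚ) (n : ℕ)
    {F : Finset K} (hF : (F : Set K) ⊆ SigmaSet p σ τ r s) :
    HasSumUniformlyOn
      (fun (ω : (SigmaSet p σ τ r s \ (F : Set K) : Set K)) z => term k ε σ r s (ω : K) z)
      (fun z => Phi k ε σ τ r s z - ∑ ω ∈ F, term k ε σ r s ω z) (HpLe p n) := by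
  refine hasSumUniformlyOn_of_finite (fun z hz => hasSum_diff_finset hK σ hk ε hτ r s hz hF)
    fun e he => ?_
  refine Set.Finite.of_finite_image (f := Subtype.val)
    ((finite_setOf_not_norm_term_le hK σ hk ε hτ r s n he).subset ?_) Subtype.val_injective.injOn
  rintro _ ⟨ω, hω, rfl⟩
  exact ⟨ω.2.1, fun h => hω fun z hz => (h z hz).2⟩

theorem convergesOnAffinoids_Phi (hK : IsQuadraticField K) (σ : K →+* ℝ) {k : ℕ} (hk : 1 ≤ k)
    (ε : ℤˣ) {τ : K} (hτ : τ ∉ Set.range ((↑) : ℚ → K)) (r s : OnePoint ℚ) :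
    ConvergesOnAffinoids k ε σ (SigmaSet p σ τ r s) r s (Phi k ε σ τ r s) := by
  intro X hX hXH
  obtain ⟨n, hn⟩ := hX.subset_HpLe hXH
  obtain ⟨F, hF, hF'⟩ := exists_poles hK σ hk ε hτ r s n
  exact ⟨F, hF, fun ω hω hωF z hz => hF' ω hω hωF z (hn hz),
    (hasSumUniformlyOn_term hK σ hk ε hτ r s n hF).mono hn⟩

/-! ### Meromorphy -/

/-- The polynomial `Q(X, 1)`. -/
noncomputable def IntForm.toPoly (p : ℕ) [Fact p.Prime] (Q : IntForm) : Polynomial ℂ_[p] :=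
  Polynomial.C (Q.a : ℂ_[p]) * Polynomial.X ^ 2 + Polynomial.C (Q.b : ℂ_[p]) * Polynomial.X +
    Polynomial.C (Q.c : ℂ_[p])

theorem IntForm.eval_toPoly (Q : IntForm) (z : ℂ_[p]) : (Q.toPoly p).eval z = Q.eval z := by
  simp [toPoly, IntForm.eval]

theorem IntForm.toPoly_ne_zero {Q : IntForm} (hQ : Q.a ≠ 0) : Q.toPoly p ≠ 0 := by
  have ha : (Q.a : ℂ_[p]) ≠ 0 := by exact_mod_cast hQ
  rw [← Polynomial.leadingCoeff_ne_zero, toPoly, Polynomial.leadingCoeff_quadratic ha]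
  exact ha

/-- A finite sum of terms is a rational function. -/
theorem exists_sum_term_eq_div (hK : IsQuadraticField K) (σ : K →+* ℝ) (k : ℕ) (ε : ℤˣ)
    (r s : OnePoint ℚ) (F : Finset K) (hF : ∀ ω ∈ F, ω ∉ Set.range ((↑) : ℚ → K)) :
    ∃ P H : Polynomial ℂ_[p], H ≠ 0 ∧
      (∀ z, (∀ ω ∈ F, (formOf σ ω).eval z ≠ 0) → H.eval z ≠ 0) ∧
      ∀ z, H.eval z ≠ 0 → ∑ ω ∈ F, term k ε σ r s ω z = P.eval z / H.eval z := by
  classical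
  induction F using Finset.induction_on with
  | empty => exact ⟨0, 1, one_ne_zero, by simp, by simp⟩
  | insert ω F hωF ih =>
    obtain ⟨P, H, hH, hHz, hsum⟩ := ih fun ω' h => hF ω' (Finset.mem_insert_of_mem h)
    have ha := formOf_a_ne_zero hK σ (hF ω (Finset.mem_insert_self _ _))
    set q := (formOf σ ω).toPoly p with hq
    set c : ℂ_[p] := (rmInter ε σ ω r s : ℂ_[p]) * ((posSqrt σ (formOf σ ω).disc : K) : ℂ_[p]) ^ k
    refine ⟨Polynomial.C c * H + P * q ^ k, q ^ k * H,
      mul_ne_zero (pow_ne_zero _ (IntForm.toPoly_ne_zero ha)) hH, fun z hz => ?_, fun z hz => ?_⟩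
    · rw [Polynomial.eval_mul, Polynomial.eval_pow, IntForm.eval_toPoly]
      exact mul_ne_zero (pow_ne_zero _ (hz ω (Finset.mem_insert_self _ _)))
        (hHz z fun ω' h => hz ω' (Finset.mem_insert_of_mem h))
    · rw [Polynomial.eval_mul] at hz
      obtain ⟨h1, h2⟩ := mul_ne_zero_iff.mp hz
      rw [Finset.sum_insert hωF, hsum z h2, term]
      simp only [Polynomial.eval_mul, Polynomial.eval_add, Polynomial.eval_pow, Polynomial.eval_C,
        IntForm.eval_toPoly, hq] at h1 ⊢
      rw [← mul_div_assoc, div_add_div _ _ h1 h2]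
      congr 1
      ring

theorem exists_norm_eval_le (H : Polynomial ℂ_[p]) (n : ℕ) :
    ∃ M : ℝ, 0 < M ∧ ∀ z ∈ HpLe p n, ‖H.eval z‖ ≤ M := by
  refine ⟨∑ i ∈ Finset.range (H.natDegree + 1), ‖H.coeff i‖ * ((p : ℝ) ^ n) ^ i + 1, ?_, ?_⟩
  · have hp := prime_pos_real (p := p)
    positivity
  · intro z hz
    rw [Polynomial.eval_eq_sum_range]
    refine (norm_sum_le _ _).trans ?_
    refine (Finset.sum_le_sum fun i _ => ?_).trans (le_add_of_nonneg_right zero_le_one)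
    rw [norm_mul, norm_pow]
    gcongr
    exact norm_le_of_mem_HpLe hz

theorem isAnalyticOnAffinoid_eval (X : Set ℂ_[p]) (P : Polynomial ℂ_[p]) :
    IsAnalyticOnAffinoid X fun z => P.eval z :=
  fun d hd => ⟨P, 1, fun z _ => by simpa using hd.le⟩

/-- `H` is bounded on `HpLe p n`, so approximating `G` within `d / M` suffices. It is applied to the
numerator of `P / H + G`. -/
theorem IsAnalyticOnAffinoid.eval_add_mul_eval {n : ℕ} {G : ℂ_[p] → ℂ_[p]}
    (hG : IsAnalyticOnAffinoid (HpLe p n) G) (P H : Polynomial ℂ_[p]) :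
    IsAnalyticOnAffinoid (HpLe p n) fun z => P.eval z + G z * H.eval z := by
  intro d hd
  obtain ⟨M, hM, hle⟩ := exists_norm_eval_le H n
  obtain ⟨A, B, h⟩ := hG (d / M) (div_pos hd hM)
  refine ⟨P * B + A * H, B, fun z hz => ⟨(h z hz).1, ?_⟩⟩
  have hB := (h z hz).1
  have : P.eval z + G z * H.eval z - (P * B + A * H).eval z / B.eval z =
      (G z - A.eval z / B.eval z) * H.eval z := by
    rw [Polynomial.eval_add, Polynomial.eval_mul, Polynomial.eval_mul]
    field_simp
    ring
  rw [this, norm_mul]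
  calc _ ≤ d / M * M := mul_le_mul (h z hz).2 (hle z hz) (norm_nonneg _) (by positivity)
    _ = d := by field_simp

theorem isRigidMeromorphic_Phi (hK : IsQuadraticField K) (σ : K →+* ℝ) {k : ℕ} (hk : 1 ≤ k)
    (ε : ℤˣ) {τ : K} (hτ : τ ∉ Set.range ((↑) : ℚ → K)) (r s : OnePoint ℚ) :
    IsRigidMeromorphic p (Phi k ε σ τ r s) := by
  classical
  intro n
  obtain ⟨F, hF, hF'⟩ := exists_poles hK σ hk ε hτ r s n
  have hirr : ∀ ω ∈ SigmaSet p σ τ r s, ω ∉ Set.range ((↑) : ℚ → K) :=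
    fun ω hω => orbit_notMem_range hτ hω.1
  obtain ⟨P, H, hH, -, hsum⟩ := exists_sum_term_eq_div hK σ k ε r s F fun ω hω => hirr ω (hF hω)
  -- With the terms in `F` removed, the partial sums are rational without poles on `HpLe p n`, so
  -- their uniform limit `G` is analytic there.
  set G : ℂ_[p] → ℂ_[p] := fun z => Phi k ε σ τ r s z - ∑ ω ∈ F, term k ε σ r s ω z with hGdef
  have hG : IsAnalyticOnAffinoid (HpLe p n) G := by
    intro d hd
    have hu := hasSumUniformlyOn_term hK σ hk ε hτ r s n hF
    rw [hasSumUniformlyOn_iff_tendstoUniformlyOn, Metric.tendstoUniformlyOn_iff] at hu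
    obtain ⟨A, hA⟩ := (hu d hd).exists
    obtain ⟨P', H', -, hH', hsum'⟩ := exists_sum_term_eq_div hK σ k ε r s
      (A.map (Function.Embedding.subtype _)) (by
        intro ω hω
        obtain ⟨ω', -, rfl⟩ := Finset.mem_map.mp hω
        exact hirr _ ω'.2.1)
    refine ⟨P', H', fun z hz => ?_⟩
    have h0 : H'.eval z ≠ 0 := hH' z fun ω hω => by
      obtain ⟨ω', -, rfl⟩ := Finset.mem_map.mp hω
      exact hF' _ ω'.2.1 ω'.2.2 z hz
    refine ⟨h0, ?_⟩
    rw [← hsum' z h0, Finset.sum_map, ← dist_eq_norm]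
    exact (hA z hz).le
  refine ⟨_, fun z => H.eval z, hG.eval_add_mul_eval P H, isAnalyticOnAffinoid_eval _ H, ?_, ?_⟩
  · by_contra! h
    refine infinite_HpLe (p := p) n ((H.roots.toFinset.finite_toSet).subset fun z hz => ?_)
    simpa [hH] using h z hz
  · intro z _ hz
    rw [add_div, mul_div_cancel_right₀ _ hz, ← hsum z hz, hGdef]
    ring

/-! ### The cocycle property -/

theorem indicator_orbit_term (k : ℕ) (ε : ℤˣ) (σ : K →+* ℝ) (τ : K) (r s : OnePoint ℚ)
    (z : ℂ_[p]) : ((orbit p τ).indicator fun ω => term k ε σ r s ω z) =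
      (SigmaSet p σ τ r s).indicator fun ω => term k ε σ r s ω z := by
  ext ω
  by_cases h1 : ω ∈ SigmaSet p σ τ r s
  · rw [Set.indicator_of_mem h1, Set.indicator_of_mem h1.1]
  · rw [Set.indicator_of_notMem h1]
    by_cases h2 : ω ∈ orbit p τ
    · rw [Set.indicator_of_mem h2, term, rmInter_eq_zero ε σ h2 h1, Int.cast_zero, zero_mul]
    · rw [Set.indicator_of_notMem h2]

/-- The index set no longer depends on `r` and `s`, so the cocycle relations can be checked term by
term. -/
theorem Phi_eq_tsum_orbit (k : ℕ) (ε : ℤˣ) (σ : K →+* ℝ) (τ : K) (r s : OnePoint ℚ) (z : ℂ_[p]) :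
    Phi k ε σ τ r s z = ∑' ω : orbit p τ, term k ε σ r s (ω : K) z := by
  rw [Phi, tsum_subtype (SigmaSet p σ τ r s) fun ω => term k ε σ r s ω z,
    tsum_subtype (orbit p τ) fun ω => term k ε σ r s ω z]
  rw [indicator_orbit_term]

theorem summable_orbit (hK : IsQuadraticField K) (σ : K →+* ℝ) {k : ℕ} (hk : 1 ≤ k)
    (ε : ℤˣ) {τ : K} (hτ : τ ∉ Set.range ((↑) : ℚ → K)) (r s : OnePoint ℚ) {n : ℕ} {z : ℂ_[p]}
    (hz : z ∈ HpLe p n) : Summable fun ω : orbit p τ => term k ε σ r s (ω : K) z := by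
  have h := (hasSum_indicator_term hK σ hk ε hτ r s hz).summable
  refine (summable_subtype_iff_indicator (f := fun ω => term k ε σ r s ω z)).mpr ?_
  rwa [indicator_orbit_term]

theorem meroEq_of_eqOn {f g : ℂ_[p] → ℂ_[p]} (h : ∀ n, ∀ z ∈ HpLe p n, f z = g z) :
    MeroEq p f g := by
  intro n
  convert Set.finite_empty
  ext z
  simp only [Set.mem_ofPred_eq, Set.mem_empty_iff_false, iff_false, not_and, not_not]
  exact h n z

theorem isRigidMeromorphicCocycle_Phi (hK : IsQuadraticField K) (σ : K →+* ℝ) {k : ℕ}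
    (hk : 1 ≤ k) (ε : ℤˣ) {τ : K} (hτ : τ ∉ Set.range ((↑) : ℚ → K)) :
    IsRigidMeromorphicCocycle p (2 * k) (Phi k ε σ τ) where
  meromorphic := isRigidMeromorphic_Phi hK σ hk ε hτ
  antisymm r s := meroEq_of_eqOn fun n z _ => by
    rw [Pi.neg_apply, Phi_eq_tsum_orbit, Phi_eq_tsum_orbit, ← tsum_neg]
    refine tsum_congr fun ω => ?_
    rw [term, term, rmInter_swap hK σ (orbit_notMem_range hτ ω.2) ε r s]
    push_cast
    ring
  add r s t := meroEq_of_eqOn fun n z hz => by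
    rw [Pi.add_apply, Phi_eq_tsum_orbit, Phi_eq_tsum_orbit, Phi_eq_tsum_orbit,
      ← (summable_orbit hK σ hk ε hτ r s hz).tsum_add (summable_orbit hK σ hk ε hτ s t hz)]
    refine tsum_congr fun ω => ?_
    rw [term, term, term, ← rmInter_add hK σ (orbit_notMem_range hτ ω.2) ε r s t]
    push_cast
    ring
  invariant γ hγ r s := meroEq_of_eqOn fun n z hz => by
    have hz' := rat_notMem_Hp (HpLe_subset_Hp n hz)
    -- Reindexing by `γ` and multiplying by a constant need no summability, so `γz` need not be
    -- located in any `HpLe p n`.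
    rw [slash, Phi_eq_tsum_orbit, Phi_eq_tsum_orbit, ← (orbitEquiv hτ hγ).tsum_eq, ← tsum_mul_left]
    refine tsum_congr fun ω => ?_
    change _ * term k ε σ _ _ (moebius γ (ω : K)) _ = _
    rw [term_moebius hK σ k ε (orbit_notMem_range hτ ω.2) γ r s hz',
      inv_mul_cancel_left₀ (pow_ne_zero _ (denom_ne_zero γ hz'))]

/-! ### Dependence on the orbit only, and the main theorem -/

theorem sigmaZeroInfty_moebius (σ : K →+* ℝ) {τ : K} (hτ : τ ∉ Set.range ((↑) : ℚ → K))
    {γ : SL(2, ℚ)} (hγ : γ ∈ Gam p) :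
    SigmaZeroInfty p σ (moebius γ τ) = SigmaZeroInfty p σ τ := by
  rw [SigmaZeroInfty, SigmaZeroInfty, orbit_moebius hτ hγ]

theorem sigmaSet_moebius (σ : K →+* ℝ) {τ : K} (hτ : τ ∉ Set.range ((↑) : ℚ → K))
    {γ : SL(2, ℚ)} (hγ : γ ∈ Gam p) (r s : OnePoint ℚ) :
    SigmaSet p σ (moebius γ τ) r s = SigmaSet p σ τ r s := by
  rw [SigmaSet, SigmaSet, orbit_moebius hτ hγ]

theorem Phi_zero_infty (hK : IsQuadraticField K) (σ : K →+* ℝ) (k : ℕ) (ε : ℤˣ) {τ : K}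
    (hτ : τ ∉ Set.range ((↑) : ℚ → K)) :
    Phi k ε σ τ ((0 : ℚ) : OnePoint ℚ) OnePoint.infty = phi k ε σ τ := by
  ext z
  rw [Phi, phi, sigmaSet_zero_infty hK p σ hτ]

end Series

end RMPeriod

theorem mainTheorem7 (p : ℕ) [Fact p.Prime] (k : ℕ) (hk : 1 ≤ k) (ε : ℤˣ)
    (τ : ℂ_[p]) (hτ : IsRM p τ) (σ : ℚ⟮τ⟯ →+* ℝ)
    (t : ℚ⟮τ⟯) (ht : t = IntermediateField.AdjoinSimple.gen ℚ τ) :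
    -- the sum defining `φ_τ` converges uniformly on affinoids, to a period function of weight `2k`
    ConvergesOnAffinoids k ε σ (SigmaZeroInfty p σ t) ((0 : ℚ) : OnePoint ℚ) OnePoint.infty
      (phi k ε σ t) ∧
    IsRigidMeromorphicPeriodFunction p (2 * k) (phi k ε σ t) ∧
    -- the sums defining `Φ_τ{r, s}` converge uniformly on affinoids, and `Φ_τ` is a cocycle
    (∀ r s : OnePoint ℚ,
      ConvergesOnAffinoids k ε σ (SigmaSet p σ t r s) r s (Phi k ε σ t r s)) ∧
    IsRigidMeromorphicCocycle p (2 * k) (Phi k ε σ t) ∧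
    -- the value of `Φ_τ` at `{0, ∞}` is `φ_τ`
    SigmaSet p σ t ((0 : ℚ) : OnePoint ℚ) OnePoint.infty = SigmaZeroInfty p σ t ∧
    Phi k ε σ t ((0 : ℚ) : OnePoint ℚ) OnePoint.infty = phi k ε σ t ∧
    -- both depend only on the orbit of `τ`
    (∀ γ ∈ Gam p, phi k ε σ (moebius γ t) = phi k ε σ t ∧
      Phi k ε σ (moebius γ t) = Phi k ε σ t) := by
  obtain ⟨hτp, hfin, -⟩ := hτ
  have hK : IsQuadraticField ℚ⟮τ⟯ := isQuadraticField_of_finrank hfin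
  -- A rational `t` would place `τ` in `ℚ_p`, outside `Hp p`.
  have ht' : t ∉ Set.range ((↑) : ℚ → ℚ⟮τ⟯) := by
    rintro ⟨q, hq⟩
    refine rat_notMem_Hp hτp ⟨q, ?_⟩
    have := congrArg (algebraMap ℚ⟮τ⟯ ℂ_[p]) (hq.trans ht)
    rwa [map_ratCast, IntermediateField.AdjoinSimple.algebraMap_gen] at this
  have hS := sigmaSet_zero_infty hK p σ ht'
  have hP := Phi_zero_infty hK σ k ε ht'
  have hcoc := isRigidMeromorphicCocycle_Phi hK σ hk ε ht'
  refine ⟨?_, ?_, convergesOnAffinoids_Phi hK σ hk ε ht', hcoc, hS, hP, fun γ hγ => ⟨?_, ?_⟩⟩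
  · rw [← hS, ← hP]
    exact convergesOnAffinoids_Phi hK σ hk ε ht' _ _
  · rw [← hP]
    exact ⟨hcoc.meromorphic _ _, _, hcoc, meroEq_of_eqOn fun _ _ _ => rfl⟩
  · ext z
    rw [phi, phi, sigmaZeroInfty_moebius σ ht' hγ]
  · ext r s z
    rw [Phi, Phi, sigmaSet_moebius σ ht' hγ]
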